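/- Let $k$ be a field of arbitrary characteristic, and let $A$ be a commutative, finitely generated $k$-algebra such that $X=\operatorname{Spec}A$ is smooth over $k$. For $i\ge 0$ let $\Omega^i=\Lambda^i_A\Omega^1_{A/k}=H^0(X,\Omega^i_X)$ be the module of $i$-forms, with de Rham differential $d:\Omega^i\to\Omega^{i+1}$, and let $HH_i(A)$ be the Hochschild homology of $A$ over $k$, that is, the homology of the complex with terms $A^{\otimes_k(i+1)}$ and differential $$b(a_0\otimes\dots\otimes a_i)=\sum_{j=0}^{i-1}(-1)^j a_0\otimes\dots\otimes a_ja_{j+1}\otimes\dots\otimes a_i+(-1)^i a_ia_0\otimes a_1\otimes\dots\otimes a_{i-1}$$ (with $b=0$ in degree $0$). Let $B:HH_i(A)\to HH_{i+1}(A)$ be the Connes–Tsygan differential, induced by the map of chains $$B(a_0\otimes\dots\otimes a_i)=\sum_{j=0}^{i}(-1)^{ij}\bigl(1\otimes a_j\otimes\dots\otimes a_i\otimes a_0\otimes\dots\otimes a_{j-1}+(-1)^{i}\,a_j\otimes\dots\otimes a_i\otimes a_0\otimes\dots\otimes a_{j-1}\otimes 1\bigr).$$ Then there are Hochschild–Kostant–Rosenberg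 isomorphisms of $k$-vector spaces $\Omega^i\cong HH_i(A)$, $i\ge 0$, which send $a_0\,da_1\wedge\dots\wedge da_i$ to the class of the cycle $\sum_{\sigma\in S_i}\operatorname{sgn}(\sigma)\,a_0\otimes a_{\sigma(1)}\otimes\dots\otimes a_{\sigma(i)}$ (and are uniquely determined by this), and under these isomorphisms $B:HH_i(A)\to HH_{i+1}(A)$ becomes the de Rham differential $d:\Omega^i\to\Omega^{i+1}$ for every $i\ge 0$. -/

import Mathlib

open scoped TensorProduct

noncomputable section

namespace HochschildHKR

section Hochschild

universe u v

theorem linearMap_sum_comp {R M N P ι : Type*} [CommRing R] [AddCommGroup M] [Module R M]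
    [AddCommGroup N] [Module R N] [AddCommGroup P] [Module R P] (s : Finset ι)
    (g : ι → N →ₗ[R] P) (f : M →ₗ[R] N) : (∑ i ∈ s, g i) ∘ₗ f = ∑ i ∈ s, g i ∘ₗ f := by
  ext x
  simp

theorem linearMap_comp_sum {R M N P ι : Type*} [CommRing R] [AddCommGroup M] [Module R M]
    [AddCommGroup N] [Module R N] [AddCommGroup P] [Module R P] (s : Finset ι)
    (g : N →ₗ[R] P) (f : ι → M →ₗ[R] N) : g ∘ₗ (∑ i ∈ s, f i) = ∑ i ∈ s, g ∘ₗ f i := by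
  ext x
  simp

variable (k : Type u) [CommRing k] (A : Type v) [CommRing A] [Algebra k A]

/-- The Hochschild chains `A ⊗ A ⊗ ⋯ ⊗ A` (`n + 1` factors over `k`), in degree `n`. -/
abbrev Chains (n : ℕ) : Type (max u v) := ⨂[k] _ : Fin (n + 1), A

variable {A}

theorem prod_fiber_update {m n : ℕ} [DecidableEq (Fin m)] (f : Fin m → Fin n) (a : Fin m → A)
    (i : Fin m) (z : A) :
    (fun j => ∏ l with f l = j, Function.update a i z l) =
      Function.update (fun j => ∏ l with f l = j, a l) (f i)
        (z * ∏ l ∈ (Finset.univ.filter fun l => f l = f i).erase i, a l) := by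
  funext j
  by_cases hj : j = f i
  · subst hj
    rw [Function.update_self, ← Finset.mul_prod_erase _ _ (a := i) (by simp)]
    congr 1
    · simp
    · refine Finset.prod_congr (by congr!) fun l hl => ?_
      rw [Function.update_of_ne (Finset.ne_of_mem_erase hl)]
  · rw [Function.update_of_ne hj]
    refine Finset.prod_congr rfl fun l hl => ?_
    rw [Function.update_of_ne]
    rintro rfl
    exact hj (Finset.mem_filter.1 hl).2.symm

/-- The map `A^{⊗ m} → A^{⊗ n}` attached to a map `f` of index sets: the `j`-th factor of the image
of `a₀ ⊗ ⋯ ⊗ a_{m-1}` is the product of the `a i` with `f i = j`, an empty product being `1`. -/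
def push {m n : ℕ} (f : Fin m → Fin n) :
    (⨂[k] _ : Fin m, A) →ₗ[k] (⨂[k] _ : Fin n, A) :=
  PiTensorProduct.lift
    { toFun := fun a => PiTensorProduct.tprod k fun j => ∏ i with f i = j, a i
      map_update_add' := by
        intro inst a i x y
        simp only [prod_fiber_update, add_mul, MultilinearMap.map_update_add]
      map_update_smul' := by
        intro inst a i c x
        simp only [prod_fiber_update, smul_mul_assoc, MultilinearMap.map_update_smul] }

theorem push_tprod {m n : ℕ} (f : Fin m → Fin n) (a : Fin m → A) :
    push k f (PiTensorProduct.tprod k a) =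
      PiTensorProduct.tprod k fun j => ∏ i with f i = j, a i := by
  simp [push]

theorem push_comp {l m n : ℕ} (g : Fin m → Fin n) (f : Fin l → Fin m) :
    (push k g ∘ₗ push k f : (⨂[k] _ : Fin l, A) →ₗ[k] _) = push k (g ∘ f) := by
  ext a
  simp only [LinearMap.compMultilinearMap_apply, LinearMap.comp_apply, push_tprod]
  congr 1
  funext j
  rw [Finset.prod_sigma']
  refine Finset.prod_bij' (fun x _ => x.2) (fun i _ => ⟨f i, i⟩) ?_ ?_ ?_ ?_ ?_ <;>
    simp +contextual

theorem push_id {m : ℕ} : (push k id : (⨂[k] _ : Fin m, A) →ₗ[k] _) = LinearMap.id := by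
  ext a
  simp only [LinearMap.compMultilinearMap_apply, push_tprod, LinearMap.id_apply]
  congr 1
  funext j
  simp [Finset.filter_eq']

/-- The map of indices underlying the `i`-th face `A^{⊗ (n+2)} → A^{⊗ (n+1)}`: for `i ≤ n` it
identifies `i` with `i + 1`, and for `i = n + 1` it identifies `n + 1` with `0`. -/
def face (n : ℕ) (i : Fin (n + 2)) (x : Fin (n + 2)) : Fin (n + 1) :=
  ⟨if x.val ≤ i.val then (if x.val = n + 1 then 0 else x.val) else x.val - 1, by
    have := x.isLt
    split_ifs <;> omega⟩

variable (A)

/-- The Hochschild differential `b`, the alternating sum of the faces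
`a₀ ⊗ ⋯ ⊗ a_i a_{i+1} ⊗ ⋯ ⊗ a_{n+1}` (`0 ≤ i ≤ n`) and
`a_{n+1} a₀ ⊗ a₁ ⊗ ⋯ ⊗ a_n` (`i = n + 1`). -/
def hochschildB (n : ℕ) : Chains k A (n + 1) →ₗ[k] Chains k A n :=
  ∑ i : Fin (n + 2), (-1 : k) ^ i.val • push k (face n i)

/-- The Connes–Tsygan operator on chains: it sends `a₀ ⊗ ⋯ ⊗ a_n` to the sum over `0 ≤ j ≤ n` of
`(-1)^{nj} (1 ⊗ a_j ⊗ ⋯ ⊗ a_n ⊗ a₀ ⊗ ⋯ ⊗ a_{j-1} + (-1)^n a_j ⊗ ⋯ ⊗ a_n ⊗ a₀ ⊗ ⋯ ⊗ a_{j-1} ⊗ 1)`. -/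
def connesChain (n : ℕ) : Chains k A n →ₗ[k] Chains k A (n + 1) :=
  ∑ j : Fin (n + 1), (-1 : k) ^ (n * j.val) •
    (push k (fun x => (x - j).succ) + (-1 : k) ^ n • push k (fun x => (x - j).castSucc))

theorem neg_smul_push {m n : ℕ} (c : k) (f : (⨂[k] _ : Fin m, A) →ₗ[k] (⨂[k] _ : Fin n, A)) :
    (-c) • f = -(c • f) :=
  neg_smul c f

theorem face_comp_face (n : ℕ) (i : Fin (n + 2)) (j : Fin (n + 3)) (h : i.val < j.val) :
    face n i ∘ face (n + 1) j =
      face n ⟨j.val - 1, by omega⟩ ∘ face (n + 1) i.castSucc := by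
  funext x
  ext
  simp only [Function.comp, face, Fin.val_castSucc]
  split_ifs <;> omega

/-- The Hochschild chains form a complex. -/
theorem hochschildB_comp (n : ℕ) : hochschildB k A n ∘ₗ hochschildB k A (n + 1) = 0 := by
  simp only [hochschildB, linearMap_sum_comp, linearMap_comp_sum, LinearMap.smul_comp,
    LinearMap.comp_smul, push_comp, Finset.smul_sum, smul_smul]
  rw [← Finset.sum_product']
  refine Finset.sum_involution
    (fun (p : Fin (n + 3) × Fin (n + 2)) _ => ((
      ⟨if p.2.val < p.1.val then p.2.val else p.2.val + 1, by split_ifs <;> omega⟩,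
      ⟨if p.2.val < p.1.val then p.1.val - 1 else p.1.val, by split_ifs <;> omega⟩) :
      Fin (n + 3) × Fin (n + 2))) ?_ ?_ ?_ ?_
  · rintro ⟨j, i⟩ -
    by_cases h : i.val < j.val
    · simp only [h, if_true]
      rw [face_comp_face n i j h]
      change _ + _ • push k (face n _ ∘ face (n + 1) i.castSucc) = 0
      rw [← add_smul]
      have : (-1 : k) ^ j.val = -(-1) ^ (j.val - 1) := by
        conv_lhs => rw [show j.val = j.val - 1 + 1 by omega, pow_succ]
        ring
      rw [this]
      convert zero_smul k _ using 2
      ring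
    · simp only [h, if_false]
      have h' := face_comp_face n ⟨j.val, by omega⟩ i.succ (by simp; omega)
      have e1 : (⟨i.succ.val - 1, by simp⟩ : Fin (n + 2)) = i := by ext; simp
      have e2 : Fin.castSucc (⟨j.val, by omega⟩ : Fin (n + 2)) = j := by ext; simp
      rw [e1, e2] at h'
      change _ + _ • push k (face n ⟨j.val, _⟩ ∘ face (n + 1) i.succ) = 0
      rw [h', ← add_smul]
      convert zero_smul k _ using 2
      ring
  · rintro ⟨j, i⟩ - -
    simp only [ne_eq, Prod.mk.injEq, Fin.ext_iff]
    split_ifs <;> omega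
  · simp
  · rintro ⟨j, i⟩ -
    simp only [Prod.mk.injEq, Fin.ext_iff]
    constructor <;> split_ifs <;> omega

/-- The cyclic norm operator, an auxiliary map. -/
def cyclicNorm (n : ℕ) : Chains k A n →ₗ[k] Chains k A n :=
  ∑ j : Fin (n + 1), (-1 : k) ^ (n * j.val) • push k (fun x => x - j)

/-- The alternating sum of all faces but the last one, an auxiliary map. -/
def barDiff (n : ℕ) : Chains k A (n + 1) →ₗ[k] Chains k A n :=
  ∑ i : Fin (n + 1), (-1 : k) ^ i.val • push k (face n i.castSucc)

theorem connesChain_eq (n : ℕ) : connesChain k A n =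
    (push k Fin.succ + (-1 : k) ^ n • push k Fin.castSucc) ∘ₗ cyclicNorm k A n := by
  simp only [connesChain, cyclicNorm, linearMap_comp_sum, LinearMap.comp_smul, LinearMap.add_comp,
    LinearMap.smul_comp, push_comp]
  rfl

theorem val_sub' {n : ℕ} (x j : Fin n) :
    (x - j).val = if j.val ≤ x.val then x.val - j.val else n + x.val - j.val := by
  split_ifs with h
  · exact Fin.sub_val_of_le h
  · exact Fin.coe_sub_iff_lt.2 (by simpa using h)

theorem barDiff_comp_cyclicNorm (n : ℕ) :
    barDiff k A n ∘ₗ cyclicNorm k A (n + 1) = cyclicNorm k A n ∘ₗ hochschildB k A n := by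
  simp only [hochschildB, barDiff, cyclicNorm, linearMap_sum_comp, linearMap_comp_sum,
    LinearMap.smul_comp, LinearMap.comp_smul, push_comp, Finset.smul_sum, smul_smul]
  rw [← Finset.sum_product', ← Finset.sum_product']
  refine Finset.sum_bij'
    (fun (p : Fin (n + 2) × Fin (n + 1)) _ => ((
      ⟨if p.2.val + p.1.val ≤ n + 1 then p.2.val + p.1.val else p.2.val + p.1.val - (n + 2), by
        split_ifs <;> omega⟩,
      ⟨if p.2.val + p.1.val ≤ n + 1 then (if p.1.val = n + 1 then 0 else p.1.val)
        else p.1.val - 1, by split_ifs <;> omega⟩) : Fin (n + 2) × Fin (n + 1)))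
    (fun (p : Fin (n + 2) × Fin (n + 1)) _ => ((
      ⟨if p.2.val = 0 ∧ p.1.val = n + 1 then n + 1 else if p.2.val ≤ p.1.val then p.2.val
        else p.2.val + 1, by split_ifs <;> omega⟩,
      ⟨if p.2.val = 0 ∧ p.1.val = n + 1 then 0 else if p.2.val ≤ p.1.val then p.1.val - p.2.val
        else p.1.val + n + 1 - p.2.val, by split_ifs <;> omega⟩) : Fin (n + 2) × Fin (n + 1)))
    (by simp) (by simp) ?_ ?_ ?_
  · rintro ⟨j, i⟩ -
    simp only [Prod.mk.injEq, Fin.ext_iff]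
    constructor <;> split_ifs <;> omega
  · rintro ⟨m, l⟩ -
    simp only [Prod.mk.injEq, Fin.ext_iff]
    constructor <;> split_ifs <;> omega
  · rintro ⟨j, i⟩ -
    dsimp only
    congr 1
    · rw [← pow_add, ← pow_add]
      split_ifs with h h'
      · refine neg_one_pow_congr ?_
        have : i.val = 0 := by omega
        simp only [this, h']
        grind
      · refine neg_one_pow_congr ?_
        grind
      · obtain ⟨t, ht⟩ : ∃ t, j.val = t + 1 := ⟨j.val - 1, by omega⟩
        obtain ⟨q, hq⟩ : ∃ q, i.val + j.val = q + (n + 2) := ⟨i.val + j.val - (n + 2), by omega⟩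
        refine neg_one_pow_congr ?_
        have : i.val = q + n + 1 - t := by omega
        rw [hq, ht]
        simp only [Nat.add_sub_cancel]
        grind
    · congr 1
      funext x
      ext
      have hx := x.isLt
      have hi := i.isLt
      have hj := j.isLt
      simp only [Function.comp, face, val_sub', Fin.val_castSucc]
      split_ifs <;> omega

theorem push_rot_comp_cyclicNorm (n : ℕ) :
    push k (fun x : Fin (n + 1) => x + 1) ∘ₗ cyclicNorm k A n =
      (-1 : k) ^ n • cyclicNorm k A n := by
  simp only [cyclicNorm, linearMap_comp_sum, LinearMap.comp_smul, push_comp, Finset.smul_sum,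
    smul_smul]
  refine Fintype.sum_equiv (Equiv.subRight (1 : Fin (n + 1))) _ _ fun j => ?_
  congr 1
  · rw [← pow_add]
    refine neg_one_pow_congr ?_
    simp only [Equiv.subRight_apply]
    rcases n with _ | m
    · simp
    · rw [val_sub', Fin.val_one]
      have := j.isLt
      split_ifs with h
      · obtain ⟨t, ht⟩ : ∃ t, j.val = t + 1 := ⟨j.val - 1, by omega⟩
        simp only [ht, Nat.add_sub_cancel]
        grind
      · have h0 : j.val = 0 := by omega
        simp only [h0]
        grind
  · congr 1
    funext x
    simp only [Function.comp, Equiv.subRight_apply]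
    abel

theorem hochschildB_comp_castSucc (n : ℕ) :
    hochschildB k A (n + 1) ∘ₗ push k Fin.castSucc = push k Fin.castSucc ∘ₗ barDiff k A n := by
  simp only [hochschildB, barDiff, linearMap_sum_comp, linearMap_comp_sum, LinearMap.smul_comp,
    LinearMap.comp_smul, push_comp]
  rw [Fin.sum_univ_castSucc, Fin.sum_univ_castSucc]
  have e1 : face (n + 1) (Fin.last (n + 2)) ∘ Fin.castSucc = id := by
    funext x
    ext
    have := x.isLt
    simp only [Function.comp, face, Fin.val_castSucc, Fin.val_last, id]
    split_ifs <;> omega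
  have e2 : face (n + 1) (Fin.last (n + 1)).castSucc ∘ Fin.castSucc = id := by
    funext x
    ext
    have := x.isLt
    simp only [Function.comp, face, Fin.val_castSucc, Fin.val_last, id]
    split_ifs <;> omega
  rw [e1, e2, add_assoc (∑ i, _), ← add_smul]
  have : (-1 : k) ^ (Fin.last (n + 1)).castSucc.val + (-1) ^ (Fin.last (n + 2)).val = 0 := by
    simp [pow_succ]
  rw [this]
  simp only [zero_smul, add_zero]
  refine Finset.sum_congr rfl fun i _ => ?_
  congr 2
  funext x
  ext
  have := i.isLt
  have := x.isLt
  simp only [Function.comp, face, Fin.val_castSucc]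
  split_ifs <;> omega

theorem hochschildB_comp_succ (n : ℕ) :
    hochschildB k A (n + 1) ∘ₗ push k Fin.succ =
      LinearMap.id - push k Fin.succ ∘ₗ barDiff k A n -
        (-1 : k) ^ (n + 1) • push k (fun x : Fin (n + 2) => x + 1) := by
  simp only [hochschildB, barDiff, linearMap_sum_comp, linearMap_comp_sum, LinearMap.smul_comp,
    LinearMap.comp_smul, push_comp]
  rw [Fin.sum_univ_castSucc, Fin.sum_univ_succ]
  have e1 : face (n + 1) (Fin.last (n + 2)) ∘ Fin.succ = fun x : Fin (n + 2) => x + 1 := by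
    funext x
    ext
    have := x.isLt
    simp only [Function.comp, face, Fin.val_add_one, Fin.val_succ, Fin.val_last, Fin.ext_iff]
    split_ifs <;> omega
  have e2 : face (n + 1) (Fin.castSucc 0) ∘ Fin.succ = id := by
    funext x
    ext
    simp [face]
  rw [e1, e2, push_id]
  have : (∑ i : Fin (n + 1), (-1 : k) ^ i.succ.castSucc.val •
      push k (A := A) (face (n + 1) i.succ.castSucc ∘ Fin.succ)) =
      -∑ i : Fin (n + 1), (-1 : k) ^ i.val • push k (Fin.succ ∘ face n i.castSucc) := by
    rw [← Finset.sum_neg_distrib]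
    refine Finset.sum_congr rfl fun i _ => ?_
    rw [← neg_smul_push]
    congr 1
    · simp [pow_succ]
    · congr 1
      funext x
      ext
      have := i.isLt
      have := x.isLt
      simp only [Function.comp, face, Fin.val_castSucc, Fin.val_succ]
      split_ifs <;> omega
  rw [this]
  simp only [Fin.castSucc_zero, Fin.val_zero, pow_zero, one_smul, Fin.val_last]
  rw [show (-1 : k) ^ (n + 2) = -(-1) ^ (n + 1) by rw [pow_succ _ (n + 1)]; ring, neg_smul_push]
  abel

theorem hochschildB_zero : hochschildB k A 0 = 0 := by
  have : face 0 1 = face 0 0 := by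
    funext x
    ext
    have := (face 0 1 x).isLt
    have := (face 0 0 x).isLt
    omega
  rw [hochschildB, Fin.sum_univ_succ, Fin.sum_univ_succ, Fin.sum_univ_zero]
  rw [show (Fin.succ 0 : Fin 2) = 1 from rfl, this, add_zero, ← add_smul]
  simp

/-- The Connes–Tsygan operator anticommutes with the Hochschild differential. -/
theorem hochschildB_comp_connesChain (n : ℕ) :
    hochschildB k A (n + 1) ∘ₗ connesChain k A (n + 1) =
      -(connesChain k A n ∘ₗ hochschildB k A n) := by
  rw [connesChain_eq, connesChain_eq, ← LinearMap.comp_assoc, LinearMap.comp_add,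
    LinearMap.comp_smul, hochschildB_comp_castSucc, hochschildB_comp_succ, LinearMap.comp_assoc,
    ← barDiff_comp_cyclicNorm]
  simp only [LinearMap.add_comp, LinearMap.sub_comp, LinearMap.smul_comp, LinearMap.comp_assoc,
    push_rot_comp_cyclicNorm, LinearMap.id_comp, smul_smul, ← pow_add]
  rw [Even.neg_one_pow ⟨n + 1, rfl⟩, pow_succ]
  simp only [one_smul, mul_neg, mul_one, neg_smul_push]
  abel

/-- The Hochschild cycles of degree `n`. -/
def cycles : (n : ℕ) → Submodule k (Chains k A n)
  | 0 => ⊤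
  | n + 1 => LinearMap.ker (hochschildB k A n)

/-- The Hochschild boundaries of degree `n`. -/
def boundaries (n : ℕ) : Submodule k (Chains k A n) :=
  LinearMap.range (hochschildB k A n)

/-- The Hochschild homology `HH_n(A) = HH_n(A, A)` over `k`: cycles modulo boundaries. -/
abbrev HH (n : ℕ) : Type (max u v) :=
  cycles k A n ⧸ (boundaries k A n).submoduleOf (cycles k A n)

variable {A} in
/-- The class in Hochschild homology of a cycle. -/
def HH.mk {n : ℕ} (z : Chains k A n) (hz : z ∈ cycles k A n) : HH k A n :=
  Submodule.Quotient.mk ⟨z, hz⟩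

theorem connesChain_mem_cycles (n : ℕ) (z : Chains k A n) (hz : z ∈ cycles k A n) :
    connesChain k A n z ∈ cycles k A (n + 1) := by
  cases n with
  | zero =>
    change hochschildB k A 0 (connesChain k A 0 z) = 0
    rw [hochschildB_zero, LinearMap.zero_apply]
  | succ n =>
    change hochschildB k A (n + 1) (connesChain k A (n + 1) z) = 0
    have h := LinearMap.congr_fun (hochschildB_comp_connesChain k A n) z
    have hz' : hochschildB k A n z = 0 := hz
    simpa [hz'] using h

/-- The Connes–Tsygan operator on cycles. -/
def connesCycles (n : ℕ) : cycles k A n →ₗ[k] cycles k A (n + 1) :=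
  (connesChain k A n).restrict (connesChain_mem_cycles k A n)

theorem connesCycles_boundaries (n : ℕ) :
    (boundaries k A n).submoduleOf (cycles k A n) ≤
      ((boundaries k A (n + 1)).submoduleOf (cycles k A (n + 1))).comap (connesCycles k A n) := by
  rintro ⟨z, hz⟩ ⟨w, hw⟩
  have hw' : hochschildB k A n w = z := hw
  refine ⟨-connesChain k A (n + 1) w, ?_⟩
  have h := LinearMap.congr_fun (hochschildB_comp_connesChain k A n) w
  simp only [LinearMap.comp_apply, LinearMap.neg_apply] at h
  rw [map_neg, h, neg_neg, hw']
  rfl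

/-- The Connes–Tsygan differential `B : HH_n(A) → HH_{n+1}(A)`. -/
def connesB (n : ℕ) : HH k A n →ₗ[k] HH k A (n + 1) :=
  Submodule.mapQ _ _ (connesCycles k A n) (connesCycles_boundaries k A n)

variable {A} in
/-- The antisymmetrization chain
`∑_σ sgn(σ) a₀ ⊗ a_{σ(1)} ⊗ ⋯ ⊗ a_{σ(n)}`, the sum being over all permutations. -/
def antisymmetrization {n : ℕ} (a₀ : A) (a : Fin n → A) : Chains k A n :=
  ∑ σ : Equiv.Perm (Fin n),
    Equiv.Perm.sign σ • PiTensorProduct.tprod k (Fin.cons a₀ (a ∘ σ) : Fin (n + 1) → A)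

end Hochschild

section DeRham

universe u v

variable (k : Type u) [CommRing k] (A : Type v) [CommRing A] [Algebra k A]

/-- The exterior algebra of the Kähler differentials, i.e. all differential forms. -/
abbrev Forms : Type v := ExteriorAlgebra A (Ω[A⁄k])

/-- The form `da`. -/
abbrev formD (a : A) : Forms k A := ExteriorAlgebra.ι A (KaehlerDifferential.D k A a)

theorem formD_add (a b : A) : formD k A (a + b) = formD k A a + formD k A b := by
  simp [formD]

theorem formD_mul (a b : A) : formD k A (a * b) = a • formD k A b + b • formD k A a := by
  simp [formD]

theorem formD_algebraMap (c : k) : formD k A (algebraMap k A c) = 0 := by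
  simp [formD]

theorem formD_zero : formD k A 0 = 0 := by
  simp [formD]

theorem formD_one : formD k A 1 = 0 := by
  simp [formD]

theorem formD_mul_formD (a b : A) : formD k A a * formD k A b = -(formD k A b * formD k A a) :=
  eq_neg_of_add_eq_zero_left (ExteriorAlgebra.ι_add_mul_swap _ _)

/-- Auxiliary: pairs of forms `(x, y)`, with the `A`-module structure
`a • (x, y) = (a x, da ∧ x + a y)`, for which `x ↦ (x, dx)` is `A`-linear. -/
@[ext]
structure Jet where
  fst : Forms k A
  snd : Forms k A

namespace Jet

variable {k A}

instance : Zero (Jet k A) := ⟨⟨0, 0⟩⟩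
instance : Add (Jet k A) := ⟨fun x y => ⟨x.fst + y.fst, x.snd + y.snd⟩⟩
instance : Neg (Jet k A) := ⟨fun x => ⟨-x.fst, -x.snd⟩⟩
instance : SMul A (Jet k A) := ⟨fun a x => ⟨a • x.fst, formD k A a * x.fst + a • x.snd⟩⟩

@[simp] theorem zero_fst : (0 : Jet k A).fst = 0 := rfl
@[simp] theorem zero_snd : (0 : Jet k A).snd = 0 := rfl
@[simp] theorem add_fst (x y : Jet k A) : (x + y).fst = x.fst + y.fst := rfl
@[simp] theorem add_snd (x y : Jet k A) : (x + y).snd = x.snd + y.snd := rfl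
@[simp] theorem neg_fst (x : Jet k A) : (-x).fst = -x.fst := rfl
@[simp] theorem neg_snd (x : Jet k A) : (-x).snd = -x.snd := rfl
@[simp] theorem smul_fst (a : A) (x : Jet k A) : (a • x).fst = a • x.fst := rfl
@[simp] theorem smul_snd (a : A) (x : Jet k A) :
    (a • x).snd = formD k A a * x.fst + a • x.snd := rfl

instance : AddCommGroup (Jet k A) where
  add_assoc x y z := by ext <;> simp [add_assoc]
  zero_add x := by ext <;> simp
  add_zero x := by ext <;> simp
  nsmul := nsmulRec
  zsmul := zsmulRec
  neg_add_cancel x := by ext <;> simp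
  add_comm x y := by ext <;> simp [add_comm]

instance : Module A (Jet k A) where
  one_smul x := by ext <;> simp [formD_one]
  mul_smul a b x := by
    ext
    · simp [mul_smul]
    · simp only [smul_snd, smul_fst, formD_mul, add_mul, smul_mul_assoc, mul_smul_comm, mul_smul,
        smul_add]
      abel
  smul_zero a := by ext <;> simp
  smul_add a x y := by
    ext
    · simp
    · simp only [smul_snd, add_snd, add_fst, mul_add, smul_add]
      abel
  add_smul a b x := by
    ext
    · simp [add_smul]
    · simp only [smul_snd, add_snd, formD_add, add_mul, add_smul]
      abel
  zero_smul x := by ext <;> simp [formD_zero]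

instance : Module k (Jet k A) := Module.compHom _ (algebraMap k A)

instance : IsScalarTower k A (Jet k A) where
  smul_assoc c a x := by
    rw [Algebra.smul_def, mul_smul]
    rfl

instance : SMulCommClass A k (Jet k A) where
  smul_comm a c x := smul_comm a (algebraMap k A c) x

/-- Auxiliary: the operator `(x, y) ↦ (da ∧ x, - da ∧ y)`. -/
def wedgeD (a : A) : Module.End A (Jet k A) where
  toFun x := ⟨formD k A a * x.fst, -(formD k A a * x.snd)⟩
  map_add' x y := by ext <;> simp [mul_add, add_comm]
  map_smul' c x := by
    ext
    · simp
    · simp only [smul_snd, mul_add, ← mul_assoc, formD_mul_formD k A a c, RingHom.id_apply,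
        mul_smul_comm, neg_mul, neg_add_rev, neg_neg, smul_neg]
      abel

@[simp] theorem wedgeD_fst (a : A) (x : Jet k A) : (wedgeD a x).fst = formD k A a * x.fst := rfl
@[simp] theorem wedgeD_snd (a : A) (x : Jet k A) :
    (wedgeD a x).snd = -(formD k A a * x.snd) := rfl

variable (k A) in
/-- Auxiliary: `a ↦ wedgeD a` as a derivation. -/
def wedgeDerivation : Derivation k A (Module.End A (Jet k A)) :=
  Derivation.mk'
    { toFun := wedgeD
      map_add' := by
        intro a b
        ext x
        · simp [formD_add, add_mul]
        · simp [formD_add, add_mul, add_comm]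
      map_smul' := by
        intro c a
        ext x
        · have : (((RingHom.id k) c • wedgeD a : Module.End A (Jet k A)) x) =
              algebraMap k A c • (wedgeD a x) := rfl
          rw [this]
          simp [Algebra.smul_def c a, formD_mul, formD_algebraMap, -algebraMap_smul]
        · have : (((RingHom.id k) c • wedgeD a : Module.End A (Jet k A)) x) =
              algebraMap k A c • (wedgeD a x) := rfl
          rw [this]
          simp [Algebra.smul_def c a, formD_mul, formD_algebraMap, -algebraMap_smul] }
    (by
      intro a b
      ext x
      · simp [formD_mul, add_mul]
      · simp only [LinearMap.coe_mk, AddHom.coe_mk, wedgeD_snd, formD_mul, add_mul,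
          LinearMap.add_apply, LinearMap.smul_apply, add_snd, smul_snd, wedgeD_fst, ← mul_assoc,
          smul_mul_assoc, formD_mul_formD k A a b, smul_neg, neg_mul]
        abel)

variable (k A) in
/-- Auxiliary: wedging with a `1`-form. -/
def wedge : Ω[A⁄k] →ₗ[A] Module.End A (Jet k A) :=
  (wedgeDerivation k A).liftKaehlerDifferential

theorem wedge_D (a : A) : wedge k A (KaehlerDifferential.D k A a) = wedgeD a :=
  Derivation.liftKaehlerDifferential_comp_D _ _

theorem wedgeD_mul_wedgeD (a b : A) :
    (wedgeD a * wedgeD b : Module.End A (Jet k A)) = -(wedgeD b * wedgeD a) := by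
  ext x <;> simp [← mul_assoc, formD_mul_formD k A a b]

theorem wedge_mul_wedge (m m' : Ω[A⁄k]) : wedge k A m * wedge k A m' = -(wedge k A m' * wedge k A m) := by
  have h1 : m ∈ Submodule.span A (Set.range (KaehlerDifferential.D k A)) := by
    rw [KaehlerDifferential.span_range_derivation]; trivial
  have h2 : m' ∈ Submodule.span A (Set.range (KaehlerDifferential.D k A)) := by
    rw [KaehlerDifferential.span_range_derivation]; trivial
  induction h1, h2 using Submodule.span_induction₂ with
  | mem_mem x y hx hy =>
    obtain ⟨a, rfl⟩ := hx
    obtain ⟨b, rfl⟩ := hy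
    rw [wedge_D, wedge_D, wedgeD_mul_wedgeD]
  | zero_left y hy => simp
  | zero_right y hy => simp
  | add_left x y z _ _ _ h h' => simp only [map_add, add_mul, mul_add, h, h']; abel
  | add_right x y z _ _ _ h h' => simp only [map_add, add_mul, mul_add, h, h']; abel
  | smul_left r x y _ _ h => simp [h]
  | smul_right r x y _ _ h => simp [h]

theorem wedge_mul_self (m : Ω[A⁄k]) : wedge k A m * wedge k A m = 0 := by
  have h1 : m ∈ Submodule.span A (Set.range (KaehlerDifferential.D k A)) := by
    rw [KaehlerDifferential.span_range_derivation]; trivial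
  induction h1 using Submodule.span_induction with
  | mem x hx =>
    obtain ⟨a, rfl⟩ := hx
    rw [wedge_D]
    ext x <;> simp [← mul_assoc]
  | zero => simp
  | add x y _ _ h h' => simp [add_mul, mul_add, h, h', wedge_mul_wedge x y]
  | smul r x _ h => simp [h]

variable (k A) in
/-- Auxiliary: the action of forms on jets. -/
def act : Forms k A →ₐ[A] Module.End A (Jet k A) :=
  ExteriorAlgebra.lift A ⟨wedge k A, wedge_mul_self⟩

theorem act_formD (a : A) : act k A (formD k A a) = wedgeD a := by
  rw [act, formD, ExteriorAlgebra.lift_ι_apply, wedge_D]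

theorem act_fst (x : Forms k A) (j : Jet k A) : (act k A x j).fst = x * j.fst := by
  induction x using ExteriorAlgebra.induction generalizing j with
  | algebraMap r => simp [Algebra.algebraMap_eq_smul_one]
  | ι m =>
    have h1 : m ∈ Submodule.span A (Set.range (KaehlerDifferential.D k A)) := by
      rw [KaehlerDifferential.span_range_derivation]; trivial
    induction h1 using Submodule.span_induction with
    | mem x hx =>
      obtain ⟨a, rfl⟩ := hx
      have := act_formD (k := k) a
      rw [formD] at this
      rw [this]
      rfl
    | zero => simp
    | add x y _ _ h h' => simp [add_mul, h, h']
    | smul r x _ h => simp [h]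
  | mul x y hx hy => simp [hx, hy, mul_assoc]
  | add x y hx hy => simp [hx, hy, add_mul]

end Jet

/-- The exterior differential on the algebra of all forms. It is determined by the three lemmas
`extD_smul`, `extD_one` and `extD_formD_mul` below, together with additivity. -/
def extD : Forms k A →ₗ[k] Forms k A where
  toFun x := (Jet.act k A x ⟨1, 0⟩).snd
  map_add' x y := by simp
  map_smul' c x := by
    rw [← algebraMap_smul A c x, RingHom.id_apply, ← algebraMap_smul A c (Jet.snd _), map_smul,
      LinearMap.smul_apply, Jet.smul_snd, formD_algebraMap, zero_mul, zero_add]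

theorem extD_smul (a : A) (x : Forms k A) :
    extD k A (a • x) = formD k A a * x + a • extD k A x := by
  simp [extD, Jet.act_fst]

theorem extD_one : extD k A 1 = 0 := by
  simp [extD]

theorem extD_formD_mul (a : A) (x : Forms k A) :
    extD k A (formD k A a * x) = -(formD k A a * extD k A x) := by
  simp only [extD, LinearMap.coe_mk, AddHom.coe_mk, map_mul, Jet.act_formD]
  rfl

theorem extD_mem (n : ℕ) (x : Forms k A) (hx : x ∈ ⋀[A]^n (Ω[A⁄k])) :
    extD k A x ∈ ⋀[A]^(n + 1) (Ω[A⁄k]) := by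
  have hD : ∀ r : A, formD k A r ∈ LinearMap.range (ExteriorAlgebra.ι A (M := Ω[A⁄k])) :=
    fun r => ⟨_, rfl⟩
  change extD k A x ∈ LinearMap.range (ExteriorAlgebra.ι A (M := Ω[A⁄k])) ^ (n + 1)
  induction hx using Submodule.pow_induction_on_left' with
  | algebraMap r =>
    rw [Algebra.algebraMap_eq_smul_one, extD_smul, extD_one, smul_zero, mul_one, add_zero,
      zero_add, pow_one]
    exact hD r
  | add x y i hx hy h h' =>
    rw [map_add]
    exact add_mem h h'
  | mem_mul m hm i x hx h =>
    obtain ⟨ω, rfl⟩ := hm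
    have h1 : ω ∈ Submodule.span A (Set.range (KaehlerDifferential.D k A)) := by
      rw [KaehlerDifferential.span_range_derivation]; trivial
    induction h1 using Submodule.span_induction with
    | mem y hy =>
      obtain ⟨a, rfl⟩ := hy
      have := extD_formD_mul k A a x
      rw [formD] at this
      rw [this, pow_succ']
      exact neg_mem (Submodule.mul_mem_mul (hD a) h)
    | zero => simp
    | add y z _ _ hy hz =>
      rw [map_add, add_mul, map_add]
      exact add_mem hy hz
    | smul r y _ hy =>
      rw [map_smul, smul_mul_assoc, extD_smul]
      refine add_mem ?_ (Submodule.smul_mem _ r hy)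
      rw [pow_succ', pow_succ']
      exact Submodule.mul_mem_mul (hD r) (Submodule.mul_mem_mul ⟨y, rfl⟩ hx)

theorem extD_ιMulti (n : ℕ) (a : Fin n → A) :
    extD k A (ExteriorAlgebra.ιMulti A n fun j => KaehlerDifferential.D k A (a j)) = 0 := by
  induction n with
  | zero => rw [ExteriorAlgebra.ιMulti_zero_apply, extD_one]
  | succ n ih =>
    rw [ExteriorAlgebra.ιMulti_succ_apply]
    have := extD_formD_mul k A (a 0)
      (ExteriorAlgebra.ιMulti A n fun j => KaehlerDifferential.D k A (a j.succ))
    rw [ih fun j => a j.succ, mul_zero, neg_zero] at this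
    exact this

/-- The de Rham differential `d : Ω^n → Ω^{n+1}`, where `Ω^n` is the `n`-th exterior power over `A`
of the module of Kähler differentials. -/
def deRham (n : ℕ) : ⋀[A]^n (Ω[A⁄k]) →ₗ[k] ⋀[A]^(n + 1) (Ω[A⁄k]) where
  toFun x := ⟨extD k A x, extD_mem k A n x x.2⟩
  map_add' x y := by ext; simp
  map_smul' c x := by ext; simp

/-- The de Rham differential sends `a₀ da₁ ∧ ⋯ ∧ da_n` to `da₀ ∧ da₁ ∧ ⋯ ∧ da_n`. -/
theorem deRham_apply (n : ℕ) (a₀ : A) (a : Fin n → A) :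
    deRham k A n (a₀ • exteriorPower.ιMulti A n fun j => KaehlerDifferential.D k A (a j)) =
      exteriorPower.ιMulti A (n + 1)
        fun j => KaehlerDifferential.D k A ((Fin.cons a₀ a : Fin (n + 1) → A) j) := by
  ext
  change extD k A (a₀ • ExteriorAlgebra.ιMulti A n _) = ExteriorAlgebra.ιMulti A (n + 1) _
  rw [extD_smul, extD_ιMulti, smul_zero, add_zero, ExteriorAlgebra.ιMulti_succ_apply]
  rfl

end DeRham

end HochschildHKR
end

/-! Both sides embed into the same space of functions, and everything is compared there. A family
`D` of `n` derivations of `A` pairs with a form by `a₀ da₁ ∧ ⋯ ∧ da_n ↦ a₀ det (D_j a_i)` and with a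
Hochschild chain by `a₀ ⊗ ⋯ ⊗ a_n ↦ a₀ D₁(a₁) ⋯ D_n(a_n)`. The second pairing kills boundaries by
the Leibniz rule (`derPairing_hochschildB`). On an antisymmetrized chain it gives the same
determinant as the form does, with no factorial, so the characteristic plays no role. If both
pairings are injective and have the same image, the isomorphism is the identification of the images
(`hkrEquiv`). The antisymmetrization formula then never has to be checked against the relations
between forms.

For forms, injectivity holds because `Ω[A⁄k]` is finite projective and its linear forms are
derivations. For homology let `S = A ⊗ A`, with diagonal ideal `I`. The bar complex is an exact
complex of flat `S`-modules in positive degrees, and its quotient by `I` is the Hochschild complex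
(`closeUp_eq_zero_iff`). Locally on `Spec A` there are étale coordinates `a_i`. The differences `a_i
⊗ 1 - 1 ⊗ a_i` then form a regular sequence, and the diagonal is a component of the subscheme they
cut out (`exists_chart`). The antisymmetrized elements `1 ⊗ a_{i₁} ⊗ ⋯ ⊗ a_{i_n} ⊗ 1` have the
differential of the Koszul complex of this sequence (`barD_antisymBar`). Induction along the
sequence shows that they generate the homology modulo the sequence (`mem_generated`), so every cycle
is locally a combination of antisymmetrizations up to boundaries. The derivations dual to the
coordinates read off the coefficients (`det_dual`), so a cycle with zero pairings is locally a
boundary. Both conclusions globalize because membership in an `S`-submodule containing the multiples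
of `I` can be tested at the primes of `A` (`mem_of_forall_prime`).

For `B`, the terms with `1` in the last place pair to zero because `D(1) = 0`. In the others, every
permutation of `n + 1` letters is uniquely a rotation followed by a permutation fixing `0`, so the
sum over rotations of an antisymmetrization is the Leibniz expansion of the full determinant `det
(D_j a_i)` with `0 ≤ i ≤ n`. That is the pairing of `da₀ ∧ ⋯ ∧ da_n` (`derPairing_connesChain`). -/

noncomputable section

namespace HochschildHKR

universe u v

/-! ### Tensor powers as algebras -/

section TensorPowers

variable (k : Type u) [CommRing k] {A : Type v} [CommRing A] [Algebra k A]

/-- The `k`-algebra map `A^{⊗ m} → B` induced by `m` algebra maps `A → B`. -/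
def tensorLift {B : Type*} [CommRing B] [Algebra k B] {m : ℕ} (f : Fin m → (A →ₐ[k] B)) :
    (⨂[k] _ : Fin m, A) →ₐ[k] B :=
  PiTensorProduct.liftAlgHom
    ((MultilinearMap.mkPiAlgebra k (Fin m) B).compLinearMap fun i => (f i).toLinearMap)
    (by simp) (by intro x y; simp [Finset.prod_mul_distrib])

@[simp] theorem tensorLift_tprod {B : Type*} [CommRing B] [Algebra k B] {m : ℕ}
    (f : Fin m → (A →ₐ[k] B)) (a : Fin m → A) :
    tensorLift k f (PiTensorProduct.tprod k a) = ∏ i, f i (a i) :=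
  (PiTensorProduct.lift.tprod a).trans (by simp)

/-- The inclusion of the `i`-th tensor factor. -/
def incl {m : ℕ} (i : Fin m) : A →ₐ[k] (⨂[k] _ : Fin m, A) :=
  PiTensorProduct.singleAlgHom (A := fun _ : Fin m => A) i

theorem incl_apply {m : ℕ} (i : Fin m) (a : A) :
    incl k i a = PiTensorProduct.tprod k (Pi.mulSingle i a) := rfl

theorem tensorLift_incl {B : Type*} [CommRing B] [Algebra k B] {m : ℕ}
    (f : Fin m → (A →ₐ[k] B)) (i : Fin m) (a : A) :
    tensorLift k f (incl k i a) = f i a := by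
  rw [incl_apply, tensorLift_tprod, Finset.prod_eq_single i]
  · simp
  · intro j _ hj
    simp [hj]
  · simp

theorem prod_incl {m : ℕ} (a : Fin m → A) :
    ∏ i, incl k i (a i) = PiTensorProduct.tprod k a := by
  simp only [incl_apply]
  refine (PiTensorProduct.tprod_prod (A := fun _ : Fin m => A) Finset.univ
    fun i => Pi.mulSingle i (a i)).symm.trans ?_
  rw [Finset.univ_prod_mulSingle a]

theorem prod_incl_comp {m n : ℕ} (f : Fin m → Fin n) (a : Fin m → A) :
    ∏ i, incl k (f i) (a i) = PiTensorProduct.tprod k fun j => ∏ i with f i = j, a i := by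
  rw [← prod_incl]
  simp only [map_prod]
  rw [← Finset.prod_fiberwise Finset.univ f]
  refine Finset.prod_congr rfl fun j _ => Finset.prod_congr rfl fun i hi => ?_
  rw [(Finset.mem_filter.1 hi).2]

/-- The map `push` as a map of algebras. -/
def pushHom {m n : ℕ} (f : Fin m → Fin n) : (⨂[k] _ : Fin m, A) →ₐ[k] (⨂[k] _ : Fin n, A) :=
  tensorLift k fun i => incl k (f i)

/-- Commutativity of `A` makes the faces ring maps; hence the bar differential is linear over the
outer factors. -/
theorem pushHom_toLinearMap {m n : ℕ} (f : Fin m → Fin n) :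
    (pushHom k f : (⨂[k] _ : Fin m, A) →ₐ[k] _).toLinearMap = push k f := by
  ext a
  simp only [LinearMap.compMultilinearMap_apply, AlgHom.toLinearMap_apply, pushHom,
    tensorLift_tprod, push_tprod, prod_incl_comp]

theorem pushHom_apply {m n : ℕ} (f : Fin m → Fin n) (x : ⨂[k] _ : Fin m, A) :
    pushHom k f x = push k f x :=
  LinearMap.congr_fun (pushHom_toLinearMap k f) x

theorem push_mul {m n : ℕ} (f : Fin m → Fin n) (x y : ⨂[k] _ : Fin m, A) :
    push k f (x * y) = push k f x * push k f y := by
  simp only [← pushHom_apply, map_mul]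

theorem push_incl {m n : ℕ} (f : Fin m → Fin n) (i : Fin m) (a : A) :
    push k f (incl k i a) = incl k (f i) a := by
  rw [← pushHom_apply, pushHom, tensorLift_incl]

theorem push_push {l m n : ℕ} (g : Fin m → Fin n) (f : Fin l → Fin m) (x : ⨂[k] _ : Fin l, A) :
    push k g (push k f x) = push k (g ∘ f) x :=
  LinearMap.congr_fun (push_comp k g f) x

theorem tensorPower_induction {m : ℕ} {p : (⨂[k] _ : Fin m, A) → Prop}
    (x : ⨂[k] _ : Fin m, A) (h : ∀ a, p (PiTensorProduct.tprod k a))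
    (hs : ∀ (c : k) x, p x → p (c • x)) (ha : ∀ x y, p x → p y → p (x + y)) : p x :=
  PiTensorProduct.induction_on x (fun r a => hs r _ (h a)) ha

theorem linearMap_sum_apply {R M P ι : Type*} [CommRing R] [AddCommGroup M] [Module R M]
    [AddCommGroup P] [Module R P] (s : Finset ι) (g : ι → M →ₗ[R] P) (x : M) :
    (∑ i ∈ s, g i) x = ∑ i ∈ s, g i x :=
  LinearMap.sum_apply s g x

end TensorPowers

/-! ### The bar complex and its quotient, the Hochschild complex -/

section BarComplex

variable (k : Type u) [CommRing k] (A : Type v) [CommRing A] [Algebra k A]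

/-- The term `A ⊗ A^{⊗ n} ⊗ A` of the bar complex. -/
abbrev Bar (n : ℕ) : Type (max u v) := ⨂[k] _ : Fin (n + 2), A

/-- The map `A ⊗ A → A^{⊗ (n + 2)}` onto the two outer factors. -/
def outer (n : ℕ) : A ⊗[k] A →ₐ[k] Bar k A n :=
  Algebra.TensorProduct.lift (incl k (0 : Fin (n + 2))) (incl k (Fin.last (n + 1)))
    fun _ _ => Commute.all _ _

instance barAlgebra (n : ℕ) : Algebra (A ⊗[k] A) (Bar k A n) := (outer k A n).toRingHom.toAlgebra

instance barScalarTower (n : ℕ) : IsScalarTower k (A ⊗[k] A) (Bar k A n) :=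
  IsScalarTower.of_algebraMap_eq fun c => ((outer k A n).commutes c).symm

variable {k A}

theorem outer_tmul (n : ℕ) (a b : A) :
    outer k A n (a ⊗ₜ b) = incl k (0 : Fin (n + 2)) a * incl k (Fin.last (n + 1)) b :=
  Algebra.TensorProduct.lift_tmul _ _ _ a b

theorem smul_bar (n : ℕ) (s : A ⊗[k] A) (x : Bar k A n) : s • x = outer k A n s * x := rfl

theorem tmul_smul_bar (n : ℕ) (a b : A) (x : Bar k A n) :
    (a ⊗ₜ[k] b) • x = (incl k (0 : Fin (n + 2)) a * incl k (Fin.last (n + 1)) b : Bar k A n) * x := by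
  rw [smul_bar, outer_tmul]

theorem push_outer {n m : ℕ} (f : Fin (n + 2) → Fin (m + 2)) (h0 : f 0 = 0)
    (hl : f (Fin.last (n + 1)) = Fin.last (m + 1)) (s : A ⊗[k] A) :
    push k f (outer k A n s) = outer k A m s := by
  have : (pushHom k f).comp (outer k A n) = outer k A m := by
    ext a
    · simp only [AlgHom.comp_apply, Algebra.TensorProduct.includeLeft_apply, outer_tmul, map_one,
        mul_one]
      exact (pushHom_apply k f _).trans ((push_incl k f 0 a).trans (by rw [h0]))
    · simp only [AlgHom.comp_apply, AlgHom.restrictScalars_apply,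
        Algebra.TensorProduct.includeRight_apply, outer_tmul, map_one, one_mul]
      exact (pushHom_apply k f _).trans ((push_incl k f _ a).trans (by rw [hl]))
  rw [← this]
  exact (pushHom_apply k f _).symm

variable (k A)

/-- The differential of the bar complex. -/
def barD (n : ℕ) : Bar k A (n + 1) →ₗ[A ⊗[k] A] Bar k A n where
  toFun x := barDiff k A (n + 1) x
  map_add' x y := map_add (barDiff k A (n + 1)) x y
  map_smul' s x := by
    change barDiff k A (n + 1) (outer k A (n + 1) s * x : Bar k A (n + 1)) =
      (outer k A n s * barDiff k A (n + 1) x : Bar k A n)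
    -- Each face occurring here fixes both ends. Only the omitted last face, which multiplies the
    -- two ends together, would fail to be linear over `A ⊗ A`.
    have key : ∀ i : Fin (n + 2), push k (face (n + 1) i.castSucc)
        (outer k A (n + 1) s * x : Bar k A (n + 1)) =
        (outer k A n s * push k (face (n + 1) i.castSucc) x : Bar k A n) := fun i => by
      rw [← push_outer (face (n + 1) i.castSucc) (n := n + 1) (m := n)]
      · exact push_mul k _ _ _
      · ext; simp [face]
      · ext
        have := i.isLt
        simp only [face, Fin.val_castSucc, Fin.val_last]
        split_ifs <;> omega
    simp only [barDiff, linearMap_sum_apply, LinearMap.smul_apply]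
    refine (Finset.sum_congr rfl fun i _ => congrArg _ (key i)).trans ?_
    refine Eq.trans ?_ (Finset.mul_sum Finset.univ _ _).symm
    exact Finset.sum_congr rfl fun i _ => (mul_smul_comm _ _ _).symm

theorem barD_apply (n : ℕ) (x : Bar k A (n + 1)) : barD k A n x = barDiff k A (n + 1) x := rfl

/-- Appending a `1` intertwines `barDiff` with the Hochschild differential, whose square is zero,
and the last face undoes the appending. -/
theorem barDiff_barDiff (n : ℕ) (x : Chains k A (n + 2)) :
    barDiff k A n (barDiff k A (n + 1) x) = 0 := by
  have h1 := LinearMap.congr_fun (hochschildB_comp_castSucc k A n) (barDiff k A (n + 1) x)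
  have h2 := LinearMap.congr_fun (hochschildB_comp_castSucc k A (n + 1)) x
  have h3 := LinearMap.congr_fun (hochschildB_comp k A (n + 1)) (push k Fin.castSucc x)
  simp only [LinearMap.comp_apply] at h1 h2 h3
  rw [← h2, h3, LinearMap.zero_apply] at h1
  have h4 := congrArg (push k (face n (Fin.last (n + 1)))) h1.symm
  rw [push_push, map_zero] at h4
  have : face n (Fin.last (n + 1)) ∘ Fin.castSucc = id := by
    funext y
    ext
    have := y.isLt
    simp only [Function.comp, face, Fin.val_castSucc, Fin.val_last, id]
    split_ifs <;> omega
  rwa [this, push_id] at h4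

theorem barD_barD (n : ℕ) (x : Bar k A (n + 2)) : barD k A n (barD k A (n + 1) x) = 0 :=
  barDiff_barDiff k A (n + 1) x

/-- Prepending a `1` is a contracting homotopy. The identity is `hochschildB_comp_succ` with the
contribution of the last face removed from both sides. -/
theorem barDiff_push_succ (n : ℕ) (x : Chains k A (n + 1)) :
    barDiff k A (n + 1) (push k Fin.succ x) = x - push k Fin.succ (barDiff k A n x) := by
  have h := LinearMap.congr_fun (hochschildB_comp_succ k A n) x
  have e : face (n + 1) (Fin.last (n + 2)) ∘ Fin.succ = fun x : Fin (n + 2) => x + 1 := by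
    funext x
    ext
    have := x.isLt
    simp only [Function.comp, face, Fin.val_add_one, Fin.val_succ, Fin.val_last, Fin.ext_iff]
    split_ifs <;> omega
  have hB : hochschildB k A (n + 1) (push k Fin.succ x) = barDiff k A (n + 1) (push k Fin.succ x)
      + (-1 : k) ^ (n + 2) • push k (fun x : Fin (n + 2) => x + 1) x := by
    rw [hochschildB, barDiff, Fin.sum_univ_castSucc, LinearMap.add_apply, LinearMap.smul_apply,
      push_push, e]
    rfl
  simp only [LinearMap.comp_apply, LinearMap.sub_apply, LinearMap.smul_apply,
    LinearMap.id_apply] at h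
  rw [hB, pow_succ _ (n + 1), mul_neg_one, neg_smul, ← sub_eq_add_neg] at h
  exact sub_left_injective h

/-- The homotopy is not linear over `A ⊗ A`, but exactness only needs the preimage `1 ⊗ x`. -/
theorem exists_barD_eq (n : ℕ) (x : Bar k A (n + 1)) (hx : barD k A n x = 0) :
    ∃ y, barD k A (n + 1) y = x := by
  refine ⟨push k Fin.succ x, ?_⟩
  have h : barDiff k A (n + 1) x = 0 := hx
  have := barDiff_push_succ k A (n + 1) x
  rw [h, map_zero, sub_zero] at this
  exact this

theorem span_one_bar_zero : Submodule.span (A ⊗[k] A) {(1 : Bar k A 0)} = ⊤ := by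
  refine top_unique fun x _ => ?_
  refine tensorPower_induction (k := k) (A := A) (m := 2)
    (p := fun x => (x : Bar k A 0) ∈ Submodule.span (A ⊗[k] A) {(1 : Bar k A 0)}) x ?_ ?_ ?_
  · intro a
    refine Submodule.mem_span_singleton.2 ⟨a 0 ⊗ₜ a 1, ?_⟩
    rw [tmul_smul_bar, mul_one, ← prod_incl, Fin.prod_univ_two]
    rfl
  · intro c x hx
    exact Submodule.smul_of_tower_mem _ c hx
  · intro x y hx hy
    exact add_mem hx hy

/-- Closing up the bar complex: the outer factors are multiplied with each other. -/
def closeUp (n : ℕ) : Bar k A n →ₗ[k] Chains k A n := push k (face n (Fin.last (n + 1)))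

theorem hochschildB_closeUp (n : ℕ) (x : Bar k A (n + 1)) :
    hochschildB k A n (closeUp k A (n + 1) x) = closeUp k A n (barD k A n x) := by
  change hochschildB k A n (push k (face (n + 1) (Fin.last (n + 2))) x) =
    push k (face n (Fin.last (n + 1))) (barDiff k A (n + 1) x)
  simp only [hochschildB, barDiff, linearMap_sum_apply, LinearMap.smul_apply, map_sum, map_smul,
    push_push]
  refine Finset.sum_congr rfl fun i _ => ?_
  congr 2
  -- The faces of the two sums match index by index: closing up is itself a last face, and it
  -- commutes with the earlier ones by the simplicial identity.
  have := face_comp_face n i (Fin.last (n + 2)) (by simp [Fin.val_last])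
  rw [this]
  rfl

theorem closeUp_smul (n : ℕ) (s : A ⊗[k] A) (x : Bar k A n) :
    closeUp k A n (s • x) =
      incl k (0 : Fin (n + 1)) (Algebra.TensorProduct.lmul' k s) * closeUp k A n x := by
  have h : ∀ y : A ⊗[k] A, closeUp k A n (outer k A n y) =
      incl k (0 : Fin (n + 1)) (Algebra.TensorProduct.lmul' k y) := fun y => by
    induction y using TensorProduct.induction_on with
    | zero => simp
    | add y z hy hz => simp only [map_add, hy, hz]
    | tmul a b =>
      rw [outer_tmul, Algebra.TensorProduct.lmul'_apply_tmul]
      refine (push_mul k _ _ _).trans ?_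
      rw [push_incl, push_incl, map_mul]
      congr 2
      · ext; simp [face]
  rw [smul_bar, ← h]
  exact push_mul k _ _ _

theorem closeUp_castSucc (n : ℕ) (x : Chains k A n) :
    closeUp k A n (push k Fin.castSucc x) = x := by
  rw [closeUp]
  refine (push_push k _ _ _).trans ?_
  have : face n (Fin.last (n + 1)) ∘ Fin.castSucc = id := by
    funext y
    ext
    have := y.isLt
    simp only [Function.comp, face, Fin.val_castSucc, Fin.val_last, id]
    split_ifs <;> omega
  rw [this, push_id]
  rfl

theorem tmul_sub_mem_ideal (a : A) : (a ⊗ₜ[k] (1 : A) - 1 ⊗ₜ a : A ⊗[k] A) ∈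
    KaehlerDifferential.ideal k A := by
  simp [KaehlerDifferential.ideal, RingHom.mem_ker]

/-- On a pure tensor, moving the last factor `a` to the front changes the tensor by a multiple of `a
⊗ 1 - 1 ⊗ a`, which lies in the diagonal ideal. -/
theorem sub_castSucc_closeUp_mem (n : ℕ) (x : Bar k A n) :
    (x - push k Fin.castSucc (closeUp k A n x) : Bar k A n) ∈
      (KaehlerDifferential.ideal k A • ⊤ : Submodule (A ⊗[k] A) (Bar k A n)) := by
  refine tensorPower_induction (k := k) (A := A) (m := n + 2)
    (p := fun x => (x - push k Fin.castSucc (closeUp k A n x) : Bar k A n) ∈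
      (KaehlerDifferential.ideal k A • ⊤ : Submodule (A ⊗[k] A) (Bar k A n))) x ?_ ?_ ?_
  · intro a
    have e : (PiTensorProduct.tprod k a : ⨂[k] _ : Fin (n + 2), A) =
        push k Fin.castSucc (PiTensorProduct.tprod k (fun i : Fin (n + 1) => a i.castSucc)) *
          incl k (Fin.last (n + 1)) (a (Fin.last _)) := by
      rw [← pushHom_apply, pushHom, tensorLift_tprod, ← prod_incl, Fin.prod_univ_castSucc]
    have e' : (push k Fin.castSucc (closeUp k A n (PiTensorProduct.tprod k a)) :
        ⨂[k] _ : Fin (n + 2), A) =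
        push k Fin.castSucc (PiTensorProduct.tprod k (fun i : Fin (n + 1) => a i.castSucc)) *
          incl k 0 (a (Fin.last _)) := by
      rw [e]
      have : closeUp k A n (push k Fin.castSucc
          (PiTensorProduct.tprod k (fun i : Fin (n + 1) => a i.castSucc)) *
          incl k (Fin.last (n + 1)) (a (Fin.last _)) : ⨂[k] _ : Fin (n + 2), A) =
          (PiTensorProduct.tprod k (fun i : Fin (n + 1) => a i.castSucc)) *
          incl k 0 (a (Fin.last _)) := by
        refine (push_mul k _ _ _).trans ?_
        rw [push_incl]
        congr 1
        · exact closeUp_castSucc k A n _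
        · congr 1
          ext
          simp [face]
      rw [this, push_mul, push_incl]
      rfl
    rw [e', e]
    have : ∀ (y u w : Bar k A n), y * u - y * w = -((w - u) * y) := by intros; ring
    rw [this]
    refine neg_mem ?_
    have h2 : ((incl k 0 (a (Fin.last _)) - incl k (Fin.last (n + 1)) (a (Fin.last _)) : Bar k A n)) =
        outer k A n (a (Fin.last _) ⊗ₜ 1 - 1 ⊗ₜ a (Fin.last _)) := by
      rw [map_sub, outer_tmul, outer_tmul]
      simp only [map_one, mul_one, one_mul]
    rw [h2, ← smul_bar]
    exact Submodule.smul_mem_smul (tmul_sub_mem_ideal k A _) trivial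
  · intro c x hx
    have := Submodule.smul_of_tower_mem _ c hx
    rw [smul_sub] at this
    simpa only [map_smul] using this
  · intro x y hx hy
    have := add_mem hx hy
    rw [← add_sub_add_comm] at this
    simpa only [map_add] using this

/-- This identifies Hochschild chains with the bar complex modulo the diagonal ideal. Questions
about cycles and boundaries become questions about the bar complex modulo that ideal. -/
theorem closeUp_eq_zero_iff (n : ℕ) (x : Bar k A n) : closeUp k A n x = 0 ↔
    x ∈ (KaehlerDifferential.ideal k A • ⊤ : Submodule (A ⊗[k] A) (Bar k A n)) := by
  constructor
  · intro h
    have := sub_castSucc_closeUp_mem k A n x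
    rwa [h, map_zero, sub_zero] at this
  · intro h
    induction h using Submodule.smul_induction_on' with
    | smul s hs y _ =>
      have : Algebra.TensorProduct.lmul' k (S := A) s = 0 := hs
      rw [closeUp_smul, this, map_zero, zero_mul]
    | add x _ y _ hx hy => rw [map_add, hx, hy, add_zero]

theorem closeUp_surjective (n : ℕ) : Function.Surjective (closeUp k A n) :=
  fun x => ⟨_, closeUp_castSucc k A n x⟩

/-- The inclusion of the inner factors into a term of the bar complex. -/
def inner (n : ℕ) : (⨂[k] _ : Fin n, A) →ₐ[k] Bar k A n :=
  pushHom k fun i => i.succ.castSucc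

/-- A term of the bar complex is induced from its inner factors. -/
def barEquiv (n : ℕ) : (A ⊗[k] A) ⊗[k] (⨂[k] _ : Fin n, A) ≃ₗ[A ⊗[k] A] Bar k A n :=
  let φ : (A ⊗[k] A) ⊗[k] (⨂[k] _ : Fin n, A) →ₐ[A ⊗[k] A] Bar k A n :=
    Algebra.TensorProduct.lift (Algebra.ofId _ _) (inner k A n) fun _ _ => Commute.all _ _
  let L := (Algebra.TensorProduct.includeLeft : (A ⊗[k] A) →ₐ[k] (A ⊗[k] A) ⊗[k] (⨂[k] _ : Fin n, A))
  -- The inverse is given factor by factor: the first and the last go to the two factors of `A ⊗ A`,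
  -- the others to the inner tensor power. As both maps are ring maps, it is enough to compare them
  -- on single factors.
  let ψ : Bar k A n →ₐ[k] (A ⊗[k] A) ⊗[k] (⨂[k] _ : Fin n, A) :=
    tensorLift k (m := n + 2) (Fin.cons (L.comp Algebra.TensorProduct.includeLeft)
      (Fin.snoc (fun i : Fin n => Algebra.TensorProduct.includeRight.comp (incl k i))
        (L.comp Algebra.TensorProduct.includeRight)))
  have hφ : ∀ s t, φ (s ⊗ₜ t) = outer k A n s * inner k A n t := fun s t =>
    Algebra.TensorProduct.lift_tmul _ _ _ _ _
  have hψ0 : ∀ a, ψ (incl k (0 : Fin (n + 2)) a) = (a ⊗ₜ 1) ⊗ₜ 1 := fun a =>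
    (tensorLift_incl k _ _ _).trans rfl
  have hψl : ∀ a, ψ (incl k (Fin.last (n + 1)) a) = (1 ⊗ₜ a) ⊗ₜ 1 := fun a =>
    (tensorLift_incl k _ _ _).trans (by
      rw [← Fin.succ_last, Fin.cons_succ, Fin.snoc_last]; rfl)
  have hψi : ∀ (i : Fin n) a, ψ (incl k (i.succ.castSucc : Fin (n + 2)) a) = 1 ⊗ₜ incl k i a :=
    fun i a => (tensorLift_incl k _ _ _).trans (by
      rw [← Fin.succ_castSucc, Fin.cons_succ, Fin.snoc_castSucc]; rfl)
  have h1 : ψ.comp (φ.restrictScalars k) = AlgHom.id k _ := by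
    apply Algebra.TensorProduct.ext
    · apply Algebra.TensorProduct.ext
      · ext a
        change ψ (φ ((a ⊗ₜ 1) ⊗ₜ 1)) = (a ⊗ₜ 1) ⊗ₜ 1
        rw [hφ, map_one, mul_one, outer_tmul, map_one, mul_one, hψ0]
      · ext a
        change ψ (φ ((1 ⊗ₜ a) ⊗ₜ 1)) = (1 ⊗ₜ a) ⊗ₜ 1
        rw [hφ, map_one, mul_one, outer_tmul, map_one, one_mul, hψl]
    · apply PiTensorProduct.algHom_ext
      intro i
      ext a
      change ψ (φ (1 ⊗ₜ incl k i a)) = 1 ⊗ₜ incl k i a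
      rw [hφ, map_one, one_mul]
      have : inner k A n (incl k i a) = incl k (i.succ.castSucc : Fin (n + 2)) a :=
        (pushHom_apply k _ _).trans (push_incl k _ _ _)
      rw [this, hψi]
  have h2 : (φ.restrictScalars k).comp ψ = AlgHom.id k _ := by
    apply PiTensorProduct.algHom_ext (A := fun _ : Fin (n + 2) => A)
    intro i
    ext a
    change φ (ψ (incl k i a)) = incl k i a
    refine Fin.cases ?_ (fun j => Fin.lastCases ?_ (fun j => ?_) j) i
    · rw [hψ0, hφ, map_one, mul_one, outer_tmul, map_one, mul_one]
    · rw [Fin.succ_last, hψl, hφ, map_one, mul_one, outer_tmul, map_one, one_mul]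
    · rw [Fin.succ_castSucc, hψi, hφ, map_one, one_mul]
      exact (pushHom_apply k _ _).trans (push_incl k _ _ _)
  LinearEquiv.ofBijective φ.toLinearMap
    (Function.bijective_iff_has_inverse.2 ⟨ψ, fun x => DFunLike.congr_fun h1 x,
      fun x => DFunLike.congr_fun h2 x⟩)

end BarComplex

/-- The module is the base change of a `k`-vector space to `A ⊗ A`. This is where it matters that
`k` is a field. -/
theorem flat_bar (k : Type u) [Field k] (A : Type v) [CommRing A] [Algebra k A] (n : ℕ) :
    Module.Flat (A ⊗[k] A) (Bar k A n) :=
  Module.Flat.of_linearEquiv (barEquiv k A n).symm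

end HochschildHKR
end

noncomputable section

namespace HochschildHKR

/-! ### Homology of a flat resolution modulo a regular sequence -/

section KoszulGeneration

open Submodule

/-- The ideal generated by the first `j` members of a finite family. -/
def initialIdeal {T : Type*} [CommRing T] {N : ℕ} (x : Fin N → T) (j : ℕ) : Ideal T :=
  Ideal.span (x '' {i | i.val < j})

theorem initialIdeal_succ {T : Type*} [CommRing T] {N : ℕ} (x : Fin N → T) {j : ℕ} (hj : j < N) :
    initialIdeal x (j + 1) = initialIdeal x j ⊔ Ideal.span {x ⟨j, hj⟩} := by
  rw [initialIdeal, initialIdeal, ← Ideal.span_union]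
  congr 1
  rw [← Set.image_singleton, ← Set.image_union]
  congr 1
  ext i
  simp only [Set.mem_ofPred_eq, Set.mem_union, Set.mem_singleton_iff, Fin.ext_iff]
  omega

theorem mem_initialIdeal {T : Type*} [CommRing T] {N : ℕ} (x : Fin N → T) {j : ℕ} {i : Fin N}
    (hi : i.val < j) : x i ∈ initialIdeal x j :=
  Ideal.subset_span ⟨i, hi, rfl⟩

/-- Multiplication by `x` is injective on `T ⧸ J`, and remains so after tensoring with the flat
module `M`, that is, on `M ⧸ J M`. -/
theorem mem_smul_top_of_flat {T M : Type*} [CommRing T] [AddCommGroup M] [Module T M]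
    [Module.Flat T M] {J : Ideal T} {x : T} (hx : ∀ t, x * t ∈ J → t ∈ J) {m : M}
    (hm : x • m ∈ (J • ⊤ : Submodule T M)) : m ∈ (J • ⊤ : Submodule T M) := by
  have hinj : Function.Injective (LinearMap.lsmul T (T ⧸ J) x) := by
    rw [injective_iff_map_eq_zero]
    intro t ht
    obtain ⟨t, rfl⟩ := Ideal.Quotient.mk_surjective t
    refine Ideal.Quotient.eq_zero_iff_mem.2 (hx t ?_)
    refine Ideal.Quotient.eq_zero_iff_mem.1 ?_
    rw [map_mul]
    exact ht
  have h := Module.Flat.rTensor_preserves_injective_linearMap (M := M) _ hinj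
  let e := TensorProduct.quotTensorEquivQuotSMul M J
  have h1 : (1 : T ⧸ J) ⊗ₜ[T] m = 0 := by
    refine h ?_
    rw [map_zero, LinearMap.rTensor_tmul, LinearMap.lsmul_apply, TensorProduct.smul_tmul]
    refine e.injective ?_
    rw [map_zero]
    refine (TensorProduct.quotTensorEquivQuotSMul_mk_tmul J 1 _).trans ?_
    rw [one_smul]
    exact (Submodule.Quotient.mk_eq_zero _).2 hm
  have h2 := congrArg e h1
  rw [map_zero] at h2
  have h3 := (TensorProduct.quotTensorEquivQuotSMul_mk_tmul J 1 m).symm.trans h2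
  rw [one_smul] at h3
  exact (Submodule.Quotient.mk_eq_zero _).1 h3

theorem map_mem_smul_top {T M M' : Type*} [CommRing T] [AddCommGroup M] [Module T M]
    [AddCommGroup M'] [Module T M'] (J : Ideal T) (f : M →ₗ[T] M') {m : M}
    (hm : m ∈ (J • ⊤ : Submodule T M)) : f m ∈ (J • ⊤ : Submodule T M') := by
  have : f m ∈ (J • ⊤ : Submodule T M).map f := mem_map_of_mem hm
  rw [map_smul''] at this
  exact (smul_mono le_rfl le_top : J • map f ⊤ ≤ J • ⊤) this

/-- The strictly decreasing multi-indices with entries below `j`. -/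
def decreasing (N j n : ℕ) : Set (Fin n → Fin N) := {I | StrictAnti I ∧ ∀ i, (I i).val < j}

theorem decreasing_mono (N j n : ℕ) : decreasing N j n ⊆ decreasing N (j + 1) n :=
  fun _ h => ⟨h.1, fun i => (h.2 i).trans (Nat.lt_succ_self j)⟩

theorem cons_mem_decreasing {N j n : ℕ} (hj : j < N) {I : Fin n → Fin N} (h : I ∈ decreasing N j n) :
    (Fin.cons ⟨j, hj⟩ I : Fin (n + 1) → Fin N) ∈ decreasing N (j + 1) (n + 1) := by
  refine ⟨?_, ?_⟩
  · intro a b hab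
    induction b using Fin.cases with
    | zero => exact absurd hab (Fin.not_lt_zero a)
    | succ b =>
      induction a using Fin.cases with
      | zero => simpa [Fin.lt_def] using h.2 b
      | succ a => simpa using h.1 (Fin.succ_lt_succ_iff.1 hab)
  · intro i
    induction i using Fin.cases with
    | zero => simp
    | succ i => simpa using (h.2 i).trans (Nat.lt_succ_self j)

variable {T : Type*} [CommRing T] (F : ℕ → Type*) [∀ n, AddCommGroup (F n)] [∀ n, Module T (F n)]
  (d : ∀ n, F (n + 1) →ₗ[T] F n) {N : ℕ} (x : Fin N → T) (η : ∀ n, (Fin n → Fin N) → F n)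

/-- The elements which are combinations of the `η I`, boundaries, and multiples of the first `j`
members of the sequence. -/
def generated (j n : ℕ) : Submodule T (F n) :=
  span T (η n '' decreasing N j n) ⊔ LinearMap.range (d n) ⊔ initialIdeal x j • ⊤

variable [∀ n, Module.Flat T (F n)]

/-- Let `F` be a complex of flat modules, exact in positive degrees, with elements `η I` satisfying
`d (η I) = ∑ ± x_{I i} η (I without i)`, and let `x` be a regular sequence. Then the homology of `F`
modulo an initial segment of `x` is generated by the `η I` over this segment. -/
theorem mem_generated
    (hdd : ∀ n z, d n (d (n + 1) z) = 0) (hex : ∀ n z, d n z = 0 → ∃ y, d (n + 1) y = z)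
    (h0 : ∀ I, span T {η 0 I} = ⊤)
    (hη : ∀ n (I : Fin (n + 1) → Fin N), d n (η (n + 1) I) =
      ∑ i, (-1 : T) ^ i.val • x (I i) • η n fun l => I (i.succAbove l))
    (hx : ∀ j (t : T), x j * t ∈ initialIdeal x j.val → t ∈ initialIdeal x j.val)
    (j : ℕ) (hj : j ≤ N) :
    (∀ z, z ∈ generated F d x η j 0) ∧
      ∀ n z, d n z ∈ (initialIdeal x j • ⊤ : Submodule T (F n)) → z ∈ generated F d x η j (n + 1) := by
  have hzero : ∀ j z, z ∈ generated F d x η j 0 := by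
    intro j z
    refine mem_sup_left (mem_sup_left ?_)
    have : (default : Fin 0 → Fin N) ∈ decreasing N j 0 :=
      ⟨fun a => a.elim0, fun a => a.elim0⟩
    have h1 : z ∈ span T {η 0 default} := by rw [h0]; trivial
    refine span_mono ?_ h1
    rintro _ rfl
    exact ⟨_, this, rfl⟩
  refine ⟨hzero j, ?_⟩
  -- Induction on the length of the segment. With no elements the claim is exactness of the complex.
  induction j with
  | zero =>
    intro n z hz
    have e : initialIdeal x 0 = ⊥ := by simp [initialIdeal]
    rw [e, bot_smul, mem_bot] at hz
    obtain ⟨y, rfl⟩ := hex n z hz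
    exact mem_sup_left (mem_sup_right ⟨y, rfl⟩)
  | succ j ih =>
    have ih := ih (by omega)
    have hjN : j < N := hj
    have hJ := initialIdeal_succ x hjN
    have hmono : ∀ n, generated F d x η j n ≤ generated F d x η (j + 1) n := fun n => by
      refine sup_le_sup (sup_le_sup_right (span_mono (Set.image_mono (decreasing_mono N j n))) _) ?_
      refine smul_mono_left ?_
      rw [hJ]
      exact le_sup_left
    intro n z hz
    rw [hJ, sup_smul, ideal_span_singleton_smul] at hz
    obtain ⟨y, hy, xw, hxw, hyz⟩ := mem_sup.1 hz
    obtain ⟨w, -, rfl⟩ := (mem_smul_pointwise_iff_exists _ _ _).1 hxw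
    -- Here `d z = y + x_j w` with `y` in `J F`, where `J` is generated by the earlier elements. In
    -- positive degree `d d z = 0` puts `x_j d w` in `J F`, and `x_j` can be cancelled, so the
    -- induction hypothesis applies to `w` too.
    have hw : w ∈ generated F d x η j n := by
      cases n with
      | zero => exact hzero j w
      | succ n =>
        refine ih n w (mem_smul_top_of_flat (hx ⟨j, hjN⟩) ?_)
        have h1 := hdd n z
        rw [← hyz, map_add, map_smul] at h1
        rw [eq_neg_of_add_eq_zero_right h1]
        exact neg_mem (map_mem_smul_top _ _ hy)
    obtain ⟨eu, heu, v, hv, rfl⟩ := mem_sup.1 hw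
    obtain ⟨e, he, _, ⟨u, rfl⟩, rfl⟩ := mem_sup.1 heu
    -- Putting `j` in front of a multi-index `I` lifts `x_j η I`: the leading term of the
    -- differential is `x_j η I` with sign `+1`, and the others have coefficients in `J`. Hence the
    -- choice of decreasing indices.
    have lift : ∃ e' ∈ span T (η (n + 1) '' decreasing N (j + 1) (n + 1)),
        d n e' - x ⟨j, hjN⟩ • e ∈ (initialIdeal x j • ⊤ : Submodule T (F n)) := by
      clear hw heu hxw hyz
      induction he using span_induction with
      | mem e he =>
        obtain ⟨I, hI, rfl⟩ := he
        refine ⟨_, subset_span ⟨_, cons_mem_decreasing hjN hI, rfl⟩, ?_⟩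
        rw [hη, Fin.sum_univ_succ]
        simp only [Fin.val_zero, pow_zero, one_smul, Fin.cons_zero, Fin.zero_succAbove,
          Fin.cons_succ, add_sub_cancel_left]
        refine sum_mem fun i _ => smul_mem _ _ (smul_mem_smul (mem_initialIdeal x (hI.2 i)) trivial)
      | zero => exact ⟨0, zero_mem _, by simp⟩
      | add a b _ _ ha hb =>
        obtain ⟨a', ha', ha⟩ := ha
        obtain ⟨b', hb', hb⟩ := hb
        refine ⟨a' + b', add_mem ha' hb', ?_⟩
        rw [map_add, smul_add, add_sub_add_comm]
        exact add_mem ha hb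
      | smul c a _ ha =>
        obtain ⟨a', ha', ha⟩ := ha
        refine ⟨c • a', smul_mem _ c ha', ?_⟩
        rw [map_smul, smul_comm, ← smul_sub]
        exact smul_mem _ c ha
    obtain ⟨e', he', hde⟩ := lift
    -- With `w = e + d u + v`, subtracting `e'` and `x_j u` removes `x_j w` from `d z` up to `J F`,
    -- so this element is covered by the induction hypothesis.
    have hz' : z - e' - x ⟨j, hjN⟩ • u ∈ generated F d x η j (n + 1) := by
      refine ih n _ ?_
      have : d n (z - e' - x ⟨j, hjN⟩ • u) =
          y + x ⟨j, hjN⟩ • v - (d n e' - x ⟨j, hjN⟩ • e) := by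
        rw [map_sub, map_sub, map_smul, ← hyz, smul_add, smul_add]
        abel
      rw [this]
      exact sub_mem (add_mem hy (smul_mem _ _ hv)) hde
    have e1 : z = (z - e' - x ⟨j, hjN⟩ • u) + e' + x ⟨j, hjN⟩ • u := by abel
    rw [e1]
    refine add_mem (add_mem (hmono _ hz') (mem_sup_left (mem_sup_left he'))) (mem_sup_right ?_)
    exact smul_mem_smul (mem_initialIdeal x (by simp)) trivial

end KoszulGeneration

end HochschildHKR
end

noncomputable section

namespace HochschildHKR

universe u v

/-! ### Expanding sums over permutations -/

section Permutations

/-- The permutations of `Fin (n + 1)` with value `i` at `0` correspond to those of `Fin n`. -/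
def permInsert {n : ℕ} (i : Fin (n + 1)) (τ : Equiv.Perm (Fin n)) : Equiv.Perm (Fin (n + 1)) :=
  i.cycleRange.symm * Equiv.Perm.decomposeFin.symm (0, τ)

@[simp] theorem permInsert_zero {n : ℕ} (i : Fin (n + 1)) (τ : Equiv.Perm (Fin n)) :
    permInsert i τ 0 = i := by
  simp [permInsert]

@[simp] theorem permInsert_succ {n : ℕ} (i : Fin (n + 1)) (τ : Equiv.Perm (Fin n)) (l : Fin n) :
    permInsert i τ l.succ = i.succAbove (τ l) := by
  simp [permInsert]

theorem sign_permInsert {n : ℕ} (i : Fin (n + 1)) (τ : Equiv.Perm (Fin n)) :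
    Equiv.Perm.sign (permInsert i τ) = (-1) ^ i.val * Equiv.Perm.sign τ := by
  rw [permInsert, map_mul, ← Equiv.Perm.inv_def, Equiv.Perm.sign_inv, Fin.sign_cycleRange,
    Equiv.Perm.decomposeFin.symm_sign]
  simp

theorem sum_perm_succ {M : Type*} [AddCommMonoid M] {n : ℕ} (g : Equiv.Perm (Fin (n + 1)) → M) :
    ∑ σ, g σ = ∑ i, ∑ τ, g (permInsert i τ) := by
  rw [← Fintype.sum_prod_type']
  refine (Function.Bijective.sum_comp (e := fun p : Fin (n + 1) × Equiv.Perm (Fin n) =>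
    permInsert p.1 p.2) ?_ g).symm
  refine (Fintype.bijective_iff_injective_and_card _).2 ⟨?_, ?_⟩
  · rintro ⟨i, τ⟩ ⟨i', τ'⟩ h
    have h0 := DFunLike.congr_fun h 0
    simp only [permInsert_zero] at h0
    subst h0
    refine Prod.ext rfl (Equiv.ext fun l => ?_)
    have hl := DFunLike.congr_fun h l.succ
    simpa using hl
  · simp [Fintype.card_perm, Nat.factorial_succ]

end Permutations

/-! ### Koszul elements in the bar complex -/

section Antisymmetrization

variable (k : Type u) [CommRing k] {A : Type v} [CommRing A] [Algebra k A]

/-- The element `1 ⊗ a₁ ⊗ ⋯ ⊗ a_n ⊗ 1` of the bar complex. -/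
def bracket {n : ℕ} (a : Fin n → A) : Bar k A n := ∏ i, incl k (i.succ.castSucc : Fin (n + 2)) (a i)

/-- The antisymmetrization of `1 ⊗ a₁ ⊗ ⋯ ⊗ a_n ⊗ 1` in the inner factors. -/
def antisymBar {n : ℕ} (a : Fin n → A) : Bar k A n :=
  ∑ σ : Equiv.Perm (Fin n), Equiv.Perm.sign σ • bracket k (a ∘ σ)

theorem push_bracket {n m : ℕ} (f : Fin (n + 2) → Fin m) (a : Fin n → A) :
    push k f (bracket k a) = ∏ i, incl k (f i.succ.castSucc) (a i) := by
  rw [← pushHom_apply, bracket, map_prod]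
  simp only [pushHom_apply, push_incl]

theorem push_bracket_swap {n m : ℕ} (f : Fin (n + 2) → Fin m) (p q : Fin n)
    (h : f p.succ.castSucc = f q.succ.castSucc) (a : Fin n → A) :
    push k f (bracket k (a ∘ Equiv.swap p q)) = push k f (bracket k a) := by
  rw [push_bracket, push_bracket]
  refine Fintype.prod_equiv (Equiv.swap p q) _ _ fun i => ?_
  simp only [Function.comp]
  congr 2
  rcases eq_or_ne i p with rfl | hp
  · rw [Equiv.swap_apply_left, h]
  · rcases eq_or_ne i q with rfl | hq
    · rw [Equiv.swap_apply_right, h]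
    · rw [Equiv.swap_apply_of_ne_of_ne hp hq]

/-- The terms of `σ` and `σ * swap p q` cancel. Cancelling in pairs avoids dividing by two. -/
theorem push_antisymBar_eq_zero {n m : ℕ} (f : Fin (n + 2) → Fin m) (p q : Fin n) (hpq : p ≠ q)
    (h : f p.succ.castSucc = f q.succ.castSucc) (a : Fin n → A) :
    ∑ σ : Equiv.Perm (Fin n), Equiv.Perm.sign σ • push k f (bracket k (a ∘ σ)) = 0 := by
  refine Finset.sum_involution (fun σ _ => σ * Equiv.swap p q) ?_ ?_ (by simp) ?_
  · intro σ _
    rw [Equiv.Perm.sign_mul, Equiv.Perm.sign_swap hpq, Equiv.Perm.coe_mul, ← Function.comp_assoc,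
      push_bracket_swap k f p q h, mul_neg_one, Units.neg_smul, add_neg_cancel]
  · intro σ _ _ h'
    exact hpq (Equiv.swap_eq_one_iff.1 (mul_eq_left.1 h'))
  · intro σ _
    simp [mul_assoc]

theorem push_face_zero_bracket {n : ℕ} (a : Fin (n + 1) → A) :
    (push k (face (n + 1) 0) (bracket k a) : Bar k A n) =
      (a 0 ⊗ₜ[k] (1 : A)) • bracket k fun i => a i.succ := by
  rw [push_bracket, Fin.prod_univ_succ, tmul_smul_bar, map_one, mul_one, bracket]
  congr 1

theorem push_face_last_bracket {n : ℕ} (a : Fin (n + 1) → A) :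
    (push k (face (n + 1) (Fin.last (n + 1)).castSucc) (bracket k a) : Bar k A n) =
      ((1 : A) ⊗ₜ[k] a (Fin.last n)) • bracket k fun i => a i.castSucc := by
  rw [push_bracket, Fin.prod_univ_castSucc, tmul_smul_bar, map_one, one_mul, bracket, mul_comm]
  congr 1
  · congr 2
    ext
    simp [face]
  · refine Finset.prod_congr rfl fun i _ => ?_
    congr 2
    ext
    have := i.isLt
    simp only [face, Fin.val_castSucc, Fin.val_last, Fin.val_succ]
    split_ifs <;> omega

/-- Expansion along the first entry. It serves the two outer faces, with `g b = b ⊗ 1` and `g b = 1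
⊗ b`. -/
theorem sum_perm_tmul_smul {n : ℕ} (g : A → A ⊗[k] A) (a : Fin (n + 1) → A) :
    ∑ σ : Equiv.Perm (Fin (n + 1)), Equiv.Perm.sign σ •
      (g (a (σ 0)) • bracket k fun i => a (σ i.succ)) =
    ∑ i, (-1 : A ⊗[k] A) ^ i.val • g (a i) • antisymBar k fun l => a (i.succAbove l) := by
  rw [sum_perm_succ]
  refine Finset.sum_congr rfl fun i _ => ?_
  rw [antisymBar, Finset.smul_sum, Finset.smul_sum]
  refine Finset.sum_congr rfl fun τ _ => ?_
  simp only [permInsert_zero, permInsert_succ, sign_permInsert, mul_smul]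
  rw [smul_comm (g (a i)) (Equiv.Perm.sign τ), smul_comm _ (Equiv.Perm.sign τ),
    smul_comm _ (Equiv.Perm.sign τ)]
  congr 1
  rcases Nat.even_or_odd i.val with h | h
  · rw [h.neg_one_pow, h.neg_one_pow, one_smul, one_smul]
    rfl
  · rw [h.neg_one_pow, h.neg_one_pow, Units.neg_smul, neg_smul, one_smul, one_smul]
    rfl

/-- A full rotation of the positions, of sign `(-1) ^ n`, moves the last entry to the front. -/
theorem sum_perm_last {M : Type*} [AddCommGroup M] {n : ℕ}
    (g : Fin (n + 1) → (Fin n → Fin (n + 1)) → M) :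
    ∑ σ : Equiv.Perm (Fin (n + 1)), Equiv.Perm.sign σ •
      g (σ (Fin.last n)) (fun i => σ i.castSucc) =
    (-1 : ℤˣ) ^ n • ∑ σ : Equiv.Perm (Fin (n + 1)), Equiv.Perm.sign σ •
      g (σ 0) (fun i => σ i.succ) := by
  rw [Finset.smul_sum]
  refine (Fintype.sum_equiv (Equiv.mulRight (finRotate (n + 1))) _ _ fun σ => ?_).symm
  rw [Equiv.coe_mulRight, Equiv.Perm.sign_mul, sign_finRotate, Nat.add_sub_cancel, smul_smul,
    mul_comm (Equiv.Perm.sign σ)]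
  congr 1
  simp only [Equiv.Perm.mul_apply, finRotate_apply, Fin.coeSucc_eq_succ,
    Fin.last_add_one]

/-- This is the Koszul differential of the sequence `a i ⊗ 1 - 1 ⊗ a i`. Every inner face multiplies
two neighbours and kills the antisymmetrization; the first and last faces give the two parts of the
difference. -/
theorem barD_antisymBar {n : ℕ} (a : Fin (n + 1) → A) :
    barD k A n (antisymBar k a) = ∑ i, (-1 : A ⊗[k] A) ^ i.val •
      (a i ⊗ₜ[k] (1 : A) - 1 ⊗ₜ a i) • antisymBar k fun l => a (i.succAbove l) := by
  have hface : ∀ i : Fin (n + 2), push k (face (n + 1) i.castSucc) (antisymBar k a) =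
      ∑ σ : Equiv.Perm (Fin (n + 1)), Equiv.Perm.sign σ •
        push k (face (n + 1) i.castSucc) (bracket k (a ∘ σ)) := fun i => by
    rw [antisymBar, map_sum]
    refine Finset.sum_congr rfl fun σ _ => ?_
    rw [Units.smul_def, Units.smul_def, map_zsmul]
  have hmid : ∀ i : Fin n, push k (face (n + 1) i.castSucc.succ.castSucc) (antisymBar k a) = 0 :=
    fun i => by
      rw [hface]
      refine push_antisymBar_eq_zero k _ i.castSucc i.succ ?_ ?_ a
      · simp [Fin.ext_iff]
      · ext
        have := i.isLt
        simp only [face, Fin.val_castSucc, Fin.val_succ]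
        split_ifs <;> omega
  rw [barD_apply, barDiff, linearMap_sum_apply, Fin.sum_univ_succ, Fin.sum_univ_castSucc]
  simp only [LinearMap.smul_apply]
  rw [Finset.sum_eq_zero fun i _ => by rw [hmid, smul_zero], zero_add, Fin.succ_last, hface, hface]
  simp only [sub_smul, smul_sub, Finset.sum_sub_distrib]
  rw [← sum_perm_tmul_smul k (fun b => b ⊗ₜ 1) a, ← sum_perm_tmul_smul k (fun b => 1 ⊗ₜ b) a,
    sub_eq_add_neg]
  congr 1
  · rw [Fin.val_zero, pow_zero, one_smul]
    refine Finset.sum_congr rfl fun σ _ => ?_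
    congr 1
    exact push_face_zero_bracket k _
  · have h1 : ∀ σ : Equiv.Perm (Fin (n + 1)),
        push k (face (n + 1) (Fin.last (n + 1)).castSucc) (bracket k (a ∘ σ)) =
        ((1 : A) ⊗ₜ[k] a (σ (Fin.last n))) • bracket k fun i => a (σ i.castSucc) :=
      fun σ => push_face_last_bracket k _
    simp only [h1]
    rw [sum_perm_last fun p f => ((1 : A) ⊗ₜ[k] a p) • bracket k fun i => a (f i)]
    -- The sign `(-1) ^ (n + 1)` of the last face and the sign `(-1) ^ n` of the rotation combine to
    -- `-1`.
    rw [Fin.val_last, Nat.succ_eq_add_one]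
    rcases Nat.even_or_odd n with h | h
    · rw [h.neg_one_pow, h.add_one.neg_one_pow, one_smul, neg_smul, one_smul]
    · rw [h.neg_one_pow, h.add_one.neg_one_pow, Units.neg_smul, one_smul, one_smul]

theorem closeUp_smul_antisymBar {n : ℕ} (s : A ⊗[k] A) (a : Fin n → A) :
    closeUp k A n (s • antisymBar k a) =
      antisymmetrization k (Algebra.TensorProduct.lmul' k s) a := by
  rw [closeUp_smul, antisymBar, map_sum, Finset.mul_sum, antisymmetrization]
  refine Finset.sum_congr rfl fun σ _ => ?_
  rw [Units.smul_def, Units.smul_def, map_zsmul, mul_smul_comm]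
  congr 1
  rw [← prod_incl, Fin.prod_univ_succ, closeUp, push_bracket]
  simp only [Fin.cons_zero, Fin.cons_succ]
  congr 1
  refine Finset.prod_congr rfl fun i _ => ?_
  congr 2
  ext
  have := i.isLt
  simp only [face, Fin.val_castSucc, Fin.val_succ, Fin.val_last]
  split_ifs <;> omega

theorem antisymBar_zero (a : Fin 0 → A) : antisymBar k a = 1 := by
  simp [antisymBar, bracket]

end Antisymmetrization

end HochschildHKR
end

noncomputable section

namespace HochschildHKR

universe u v

/-! ### Étale coordinates on a smooth algebra -/

section Coordinates

open KaehlerDifferential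

/-- Around any point of a smooth algebra there are coordinates: elements whose differentials form a
basis of the module of differentials. -/
theorem exists_basis_kaehlerDifferential (k : Type u) [CommRing k] {A : Type v} [CommRing A]
    [Algebra k A] [Algebra.Smooth k A] (p : Ideal A) [p.IsPrime] :
    ∃ f ∉ p, ∃ (N : ℕ) (a : Fin N → A)
      (b : Module.Basis (Fin N) (Localization.Away f) (Ω[Localization.Away f⁄k])),
      ∀ i, b i = D k _ (algebraMap A (Localization.Away f) (a i)) := by
  -- Over the local ring at `p` the differentials are finite and flat, so a basis can be chosen
  -- among the spanning elements `da` with `a` in `A`.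
  obtain ⟨κ, a, b, hb⟩ := Module.exists_basis_of_span_of_flat _
    (span_range_map_derivation_of_isLocalization k _ (Localization.AtPrime p) p.primeCompl)
  let e : (κ →₀ A) →ₗ[A] Ω[A⁄k] :=
    Finsupp.linearCombination A fun i : κ ↦ D k A (a i)
  let l₁ : (κ →₀ A) →ₗ[A] (κ →₀ Localization.AtPrime p) :=
    Finsupp.mapRange.linearMap (Algebra.linearMap A (Localization.AtPrime p))
  let l₂ : Ω[A⁄k] →ₗ[A] Ω[Localization.AtPrime p⁄k] := map k k A (Localization.AtPrime p)
  let eₚ : (κ →₀ Localization.AtPrime p) →ₗ[Localization.AtPrime p] Ω[Localization.AtPrime p⁄k] :=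
    IsLocalizedModule.mapExtendScalars p.primeCompl l₁ l₂ (Localization.AtPrime p) e
  have : eₚ = b.repr.symm := by
    ext i
    trans IsLocalizedModule.map p.primeCompl l₁ l₂ e <| l₁ <| Finsupp.single i 1
    · simp [eₚ, -IsLocalizedModule.map_apply, l₁]
    · simp [l₂, e, hb]
  have heₚ : Function.Bijective eₚ := this ▸ b.repr.symm.bijective
  have : Finite κ := Module.Finite.finite_basis b
  -- The map from the free module onto the chosen differentials is bijective at `p`. By finite
  -- presentation it stays so after inverting one element outside `p`.
  obtain ⟨g, hg, h⟩ := Module.FinitePresentation.exists_notMem_bijective e p l₁ l₂ heₚ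
  let l₁ₜ : (κ →₀ A) →ₗ[A] (κ →₀ Localization.Away g) :=
    Finsupp.mapRange.linearMap (Algebra.linearMap A _)
  let l₂ₜ : Ω[A⁄k] →ₗ[A] Ω[Localization.Away g⁄k] :=
    map k k A (Localization.Away g)
  rw [← IsLocalizedModule.map_bijective_iff_localizedModuleMap_bijective l₁ₜ l₂ₜ] at h
  let eₜ' : (κ →₀ Localization.Away g) →ₗ[Localization.Away g] Ω[Localization.Away g⁄k] :=
    IsLocalizedModule.mapExtendScalars (Submonoid.powers g) l₁ₜ l₂ₜ (Localization.Away g) e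
  let b' : Module.Basis κ (Localization.Away g) (Ω[Localization.Away g⁄k]) :=
    .ofRepr (LinearEquiv.ofBijective eₜ' h).symm
  have hb' : ∀ i, b' i = D k _ (algebraMap A (Localization.Away g) (a i)) := fun i => by
    change eₜ' (Finsupp.single i 1) = _
    trans IsLocalizedModule.map (Submonoid.powers g) l₁ₜ l₂ₜ e <| l₁ₜ <| Finsupp.single i 1
    · simp [eₜ', -IsLocalizedModule.map_apply, l₁ₜ]
    · simp [l₂ₜ, e]
  obtain ⟨N, ⟨ε⟩⟩ := Finite.exists_equiv_fin κ
  exact ⟨g, hg, N, fun i => a (ε.symm i), b'.reindex ε, fun i => by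
    rw [Module.Basis.reindex_apply, hb']⟩

/-- An algebra with coordinates is étale over the polynomial ring. -/
theorem etale_of_basis_kaehlerDifferential {k : Type u} [CommRing k] {N : ℕ} {L : Type v}
    [CommRing L] [Algebra k L] [Algebra (MvPolynomial (Fin N) k) L]
    [IsScalarTower k (MvPolynomial (Fin N) k) L] [Algebra.Smooth k L]
    (b : Module.Basis (Fin N) L (Ω[L⁄k]))
    (hb : ∀ i, b i = D k L (algebraMap (MvPolynomial (Fin N) k) L (MvPolynomial.X i))) :
    Algebra.Etale (MvPolynomial (Fin N) k) L := by
  set P := MvPolynomial (Fin N) k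
  have hbij : Function.Bijective (mapBaseChange k P L) := by
    have : mapBaseChange k P L =
        (((mvPolynomialBasis k (Fin N)).baseChange L).equiv b (Equiv.refl _)).toLinearMap := by
      refine ((mvPolynomialBasis k (Fin N)).baseChange L).ext fun i => ?_
      rw [LinearEquiv.coe_coe, Module.Basis.equiv_apply, Module.Basis.baseChange_apply,
        mapBaseChange_tmul, mvPolynomialBasis_apply, one_smul, map_D, Equiv.refl_apply, hb]
    rw [this]
    exact LinearEquiv.bijective _
  have h1 : Subsingleton (Ω[L⁄P]) := by
    refine subsingleton_of_forall_eq 0 fun y => ?_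
    obtain ⟨y, rfl⟩ := map_surjective k P L y
    obtain ⟨z, rfl⟩ := hbij.2 y
    exact (exact_mapBaseChange_map k P L).apply_apply_eq_zero z
  -- In the cotangent sequence of `k → P → L` the map `L ⊗ Ω[P⁄k] → Ω[L⁄k]` takes a basis to a
  -- basis. Injectivity makes `δ` vanish, so every class comes from `H1Cotangent k L`, which is zero
  -- by smoothness; surjectivity gave `Ω[L⁄P] = 0` above.
  have h2 : Subsingleton (Algebra.H1Cotangent P L) := by
    refine subsingleton_of_forall_eq 0 fun y => ?_
    have hy : Algebra.H1Cotangent.δ k P L y = 0 := by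
      refine hbij.1 ?_
      rw [map_zero]
      exact (Algebra.H1Cotangent.exact_δ_mapBaseChange k P L).apply_apply_eq_zero y
    obtain ⟨z, rfl⟩ := (Algebra.H1Cotangent.exact_map_δ k P L y).1 hy
    rw [Subsingleton.elim z 0, map_zero]
  exact ⟨⟨h1, h2⟩, Algebra.FinitePresentation.of_restrict_scalars_finitePresentation k P L⟩

end Coordinates

/-! ### The diagonal in étale coordinates -/

section Diagonal

open MvPolynomial

/-- Membership in an ideal generated by variables is tested on monomials, and multiplying by `X i`
does not affect the exponents of the variables in `s`. -/
theorem mem_span_X_of_X_mul_mem {R σ : Type*} [CommRing R] {s : Set σ} {i : σ} (hi : i ∉ s)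
    {t : MvPolynomial σ R} (h : X i * t ∈ Ideal.span (X '' s)) : t ∈ Ideal.span (X '' s) := by
  rw [mem_ideal_span_X_image] at h ⊢
  intro m hm
  obtain ⟨l, hl, hml⟩ := h (Finsupp.single i 1 + m) (by
    rw [mem_support_iff, coeff_X_mul]
    exact mem_support_iff.1 hm)
  refine ⟨l, hl, ?_⟩
  have : i ≠ l := fun e => hi (e ▸ hl)
  simpa [Finsupp.single_apply, this] using hml

/-- The involution of `R[X]` which sends `X i` to `c i - X i`. -/
def reflectEquiv {R σ : Type*} [CommRing R] (c : σ → R) : MvPolynomial σ R ≃ₐ[R] MvPolynomial σ R :=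
  AlgEquiv.ofAlgHom (aeval fun i => C (c i) - X i) (aeval fun i => C (c i) - X i)
    (by ext i; simp [MvPolynomial.algebraMap_eq]) (by ext i; simp [MvPolynomial.algebraMap_eq])

theorem map_initialIdeal {T T' : Type*} [CommRing T] [CommRing T'] (g : T →+* T') {N : ℕ}
    (x : Fin N → T) (j : ℕ) :
    (initialIdeal x j).map g = initialIdeal (fun i => g (x i)) j := by
  rw [initialIdeal, Ideal.map_span, ← Set.image_comp]
  rfl

/-- The differences `X i ⊗ 1 - 1 ⊗ X i` form a regular sequence. -/
theorem mem_of_diagonal_mul_mem (k : Type*) [CommRing k] {N : ℕ} (j : Fin N)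
    (t : MvPolynomial (Fin N) k ⊗[k] MvPolynomial (Fin N) k)
    (ht : (X j ⊗ₜ 1 - 1 ⊗ₜ X j) * t ∈
      initialIdeal (fun i : Fin N => (X i ⊗ₜ[k] 1 - 1 ⊗ₜ X i :
        MvPolynomial (Fin N) k ⊗[k] MvPolynomial (Fin N) k)) j.val) :
    t ∈ initialIdeal (fun i : Fin N => (X i ⊗ₜ[k] 1 - 1 ⊗ₜ X i :
        MvPolynomial (Fin N) k ⊗[k] MvPolynomial (Fin N) k)) j.val := by
  -- Over the left factor the tensor square is a polynomial ring in the `1 ⊗ X i`. The difference `X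
  -- i ⊗ 1 - 1 ⊗ X i` becomes `C (X i) - X i`, which the reflection sends to the variable `X i`.
  let e : (MvPolynomial (Fin N) k) ⊗[k] (MvPolynomial (Fin N) k) ≃ₐ[(MvPolynomial (Fin N) k)] MvPolynomial (Fin N) (MvPolynomial (Fin N) k) :=
    (MvPolynomial.algebraTensorAlgEquiv k (MvPolynomial (Fin N) k)).trans (reflectEquiv fun i => (X i : (MvPolynomial (Fin N) k)))
  have he : ∀ i : Fin N, e (X i ⊗ₜ 1 - 1 ⊗ₜ X i) = X i := fun i => by
    simp only [e, AlgEquiv.trans_apply, map_sub, MvPolynomial.algebraTensorAlgEquiv_tmul]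
    simp [reflectEquiv, MvPolynomial.smul_eq_C_mul]
  have hmap : (initialIdeal (fun i : Fin N => (X i ⊗ₜ[k] 1 - 1 ⊗ₜ X i : (MvPolynomial (Fin N) k) ⊗[k] (MvPolynomial (Fin N) k))) j.val).map
      (e : (MvPolynomial (Fin N) k) ⊗[k] (MvPolynomial (Fin N) k) →+* MvPolynomial (Fin N) (MvPolynomial (Fin N) k)) =
      Ideal.span (X '' {i : Fin N | i.val < j.val}) := by
    rw [map_initialIdeal]
    simp only [RingHom.coe_coe, he]
    rfl
  have h1 := Ideal.mem_map_of_mem (e : (MvPolynomial (Fin N) k) ⊗[k] (MvPolynomial (Fin N) k) →+* MvPolynomial (Fin N) (MvPolynomial (Fin N) k)) ht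
  rw [hmap, RingHom.coe_coe, map_mul, he] at h1
  have h2 := mem_span_X_of_X_mul_mem (by simp) h1
  rw [← hmap] at h2
  obtain ⟨t', ht', hte⟩ := (Ideal.mem_map_iff_of_surjective
    (e : (MvPolynomial (Fin N) k) ⊗[k] (MvPolynomial (Fin N) k) →+* MvPolynomial (Fin N) (MvPolynomial (Fin N) k)) e.surjective).1 h2
  rwa [← e.injective hte]

variable {k : Type u} [CommRing k] {N : ℕ} {L : Type v} [CommRing L] [Algebra k L]
  [Algebra (MvPolynomial (Fin N) k) L] [IsScalarTower k (MvPolynomial (Fin N) k) L]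
  [Algebra.Etale (MvPolynomial (Fin N) k) L]

variable (k N L) in
/-- The differences `x i ⊗ 1 - 1 ⊗ x i` of the coordinates. -/
def coordDiff (i : Fin N) : L ⊗[k] L :=
  algebraMap (MvPolynomial (Fin N) k) L (X i) ⊗ₜ 1 - 1 ⊗ₜ algebraMap (MvPolynomial (Fin N) k) L (X i)

/-- Étale algebras are flat, so `L ⊗ L` is flat over the tensor square of the polynomial ring, and
regularity of the sequence `X i ⊗ 1 - 1 ⊗ X i` survives flat base change. -/
theorem mem_of_coordDiff_mul_mem (j : Fin N) (t : L ⊗[k] L)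
    (ht : coordDiff k N L j * t ∈ initialIdeal (coordDiff k N L) j.val) :
    t ∈ initialIdeal (coordDiff k N L) j.val := by
  let g : (MvPolynomial (Fin N) k) ⊗[k] (MvPolynomial (Fin N) k) →ₐ[k] L ⊗[k] L :=
    Algebra.TensorProduct.map (IsScalarTower.toAlgHom k (MvPolynomial (Fin N) k) L) (IsScalarTower.toAlgHom k (MvPolynomial (Fin N) k) L)
  have hflat : (IsScalarTower.toAlgHom k (MvPolynomial (Fin N) k) L).toRingHom.Flat := by
    have : Module.Flat (MvPolynomial (Fin N) k) L := inferInstance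
    exact RingHom.flat_algebraMap_iff.2 this
  have hg : g.toRingHom.Flat := RingHom.Flat.tensorProductMap hflat hflat
  let := g.toRingHom.toAlgebra
  have : Module.Flat ((MvPolynomial (Fin N) k) ⊗[k] (MvPolynomial (Fin N) k)) (L ⊗[k] L) := hg
  let w : Fin N → (MvPolynomial (Fin N) k) ⊗[k] (MvPolynomial (Fin N) k) := fun i => X i ⊗ₜ[k] 1 - 1 ⊗ₜ X i
  have hw : (fun i => algebraMap ((MvPolynomial (Fin N) k) ⊗[k] (MvPolynomial (Fin N) k)) (L ⊗[k] L) (w i)) = coordDiff k N L := by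
    funext i
    change g (w i) = _
    simp [g, w, coordDiff]
  have hJ : ∀ y : L ⊗[k] L, y ∈ initialIdeal (coordDiff k N L) j.val ↔
      y ∈ (initialIdeal w j.val • ⊤ : Submodule ((MvPolynomial (Fin N) k) ⊗[k] (MvPolynomial (Fin N) k)) (L ⊗[k] L)) := fun y => by
    rw [Ideal.smul_top_eq_map, map_initialIdeal, hw]
    rfl
  rw [hJ] at ht ⊢
  refine mem_smul_top_of_flat (x := w j) (mem_of_diagonal_mul_mem k j) ?_
  rw [Algebra.smul_def, ← congrFun hw j] at *
  exact ht

/-- The diagonal is a union of components of the locus where the coordinates agree. -/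
theorem exists_diagonal_idempotent : ∃ t : L ⊗[k] L,
    (∀ s : L, (1 ⊗ₜ s - s ⊗ₜ 1) * t ∈ initialIdeal (coordDiff k N L) N) ∧
      Algebra.TensorProduct.lmul' k t = 1 := by
  let J := initialIdeal (coordDiff k N L) N
  let l : L →ₐ[k] (L ⊗[k] L) ⧸ J :=
    (Ideal.Quotient.mkₐ k J).comp Algebra.TensorProduct.includeLeft
  let r : L →ₐ[k] (L ⊗[k] L) ⧸ J :=
    (Ideal.Quotient.mkₐ k J).comp Algebra.TensorProduct.includeRight
  have hlr : r.comp (IsScalarTower.toAlgHom k (MvPolynomial (Fin N) k) L) = l.comp (IsScalarTower.toAlgHom k (MvPolynomial (Fin N) k) L) := by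
    refine MvPolynomial.algHom_ext fun i => ?_
    refine (sub_eq_zero.1 ?_).symm
    refine Eq.trans (map_sub (Ideal.Quotient.mkₐ k J) _ _).symm ?_
    exact Ideal.Quotient.eq_zero_iff_mem.2 (mem_initialIdeal (coordDiff k N L) i.isLt)
  let lP : L →ₐ[(MvPolynomial (Fin N) k)] (L ⊗[k] L) ⧸ J := { l.toRingHom with commutes' := fun _ => rfl }
  let rP : L →ₐ[(MvPolynomial (Fin N) k)] (L ⊗[k] L) ⧸ J :=
    { r.toRingHom with commutes' := fun q => DFunLike.congr_fun hlr q }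
  -- Modulo `J` the two inclusions of `L` agree on the coordinates, hence on the polynomial ring
  -- `P`, so the quotient receives a map from `L ⊗[P] L`.
  let φ : L ⊗[(MvPolynomial (Fin N) k)] L →ₐ[(MvPolynomial (Fin N) k)] (L ⊗[k] L) ⧸ J :=
    Algebra.TensorProduct.lift lP rP fun _ _ => Commute.all _ _
  let μ : (L ⊗[k] L) ⧸ J →+* L := Ideal.Quotient.lift J
    (Algebra.TensorProduct.lmul' k : L ⊗[k] L →ₐ[k] L).toRingHom (by
      intro y hy
      have : J ≤ RingHom.ker (Algebra.TensorProduct.lmul' k : L ⊗[k] L →ₐ[k] L).toRingHom := by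
        refine Ideal.span_le.2 ?_
        rintro _ ⟨i, -, rfl⟩
        simp [coordDiff, RingHom.mem_ker]
      exact this hy)
  have hμφ : ∀ y, μ (φ y) = Algebra.TensorProduct.lmul' (MvPolynomial (Fin N) k) y := fun y => by
    induction y using TensorProduct.induction_on with
    | zero => simp
    | add y z hy hz => simp only [map_add, hy, hz]
    | tmul a b =>
      have : φ (a ⊗ₜ b) = Ideal.Quotient.mk J (a ⊗ₜ b) := by
        refine (Algebra.TensorProduct.lift_tmul lP rP _ a b).trans ?_
        change Ideal.Quotient.mk J (a ⊗ₜ 1) * Ideal.Quotient.mk J (1 ⊗ₜ b) = _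
        rw [← map_mul]
        simp
      rw [this, Algebra.TensorProduct.lmul'_apply_tmul]
      exact Algebra.TensorProduct.lmul'_apply_tmul (R := k) a b
  -- The required `t` lifts the image of the separability element of the unramified extension `L` of
  -- `P`, which is killed by the diagonal ideal and multiplies out to `1`.
  obtain ⟨t, ht⟩ := Ideal.Quotient.mk_surjective (φ (Algebra.FormallyUnramified.elem (MvPolynomial (Fin N) k) L))
  refine ⟨t, fun s => ?_, ?_⟩
  · refine Ideal.Quotient.eq_zero_iff_mem.1 ?_
    rw [map_mul, ht]
    have h := congrArg φ (Algebra.FormallyUnramified.one_tmul_sub_tmul_one_mul_elem (R := (MvPolynomial (Fin N) k)) s)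
    rw [map_zero, map_mul] at h
    rw [← h]
    congr 1
    have h1 : φ (1 ⊗ₜ s) = Ideal.Quotient.mk J (1 ⊗ₜ s) :=
      (Algebra.TensorProduct.lift_tmul lP rP _ 1 s).trans (by rw [map_one, one_mul]; rfl)
    have h2 : φ (s ⊗ₜ 1) = Ideal.Quotient.mk J (s ⊗ₜ 1) :=
      (Algebra.TensorProduct.lift_tmul lP rP _ s 1).trans (by rw [map_one, mul_one]; rfl)
    rw [map_sub, map_sub, h1, h2]
  · have h := hμφ (Algebra.FormallyUnramified.elem (MvPolynomial (Fin N) k) L)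
    rw [Algebra.FormallyUnramified.lmul_elem, ← ht] at h
    exact h

end Diagonal

end HochschildHKR
end

noncomputable section

namespace HochschildHKR

universe u v

/-! ### Localizing the tensor square -/

section Chart

open KaehlerDifferential

variable {k : Type u} [CommRing k] {A L : Type v} [CommRing A] [Algebra k A] [CommRing L]
  [Algebra k L] [Algebra A L] [IsScalarTower k A L]

variable (k A L) in
/-- The map `A ⊗ A → L ⊗ L`. -/
def tensorSquareMap : A ⊗[k] A →ₐ[k] L ⊗[k] L :=
  Algebra.TensorProduct.map (IsScalarTower.toAlgHom k A L) (IsScalarTower.toAlgHom k A L)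

theorem tensorSquareMap_tmul (a b : A) : tensorSquareMap k A L (a ⊗ₜ b) =
    algebraMap A L a ⊗ₜ algebraMap A L b := rfl

theorem isUnit_tensorSquareMap (f : A) [IsLocalization.Away f L] :
    IsUnit (tensorSquareMap k A L (f ⊗ₜ f)) := by
  have h : IsUnit (algebraMap A L f) := IsLocalization.Away.algebraMap_isUnit f
  have h1 := h.map (Algebra.TensorProduct.includeLeft : L →ₐ[k] L ⊗[k] L)
  have h2 := h.map (Algebra.TensorProduct.includeRight : L →ₐ[k] L ⊗[k] L)
  have h3 := h1.mul h2
  simpa [tensorSquareMap_tmul] using h3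

/-- Since `f ⊗ f = (f ⊗ 1) * (1 ⊗ f)`, inverting it inverts `f` in both factors. The universal
properties then give mutually inverse maps. -/
theorem isLocalization_tensorSquare [Algebra (A ⊗[k] A) (L ⊗[k] L)]
    (halg : algebraMap (A ⊗[k] A) (L ⊗[k] L) = (tensorSquareMap k A L).toRingHom)
    (f : A) [IsLocalization.Away f L] : IsLocalization.Away (f ⊗ₜ[k] f : A ⊗[k] A) (L ⊗[k] L) := by
  let T := Localization.Away (f ⊗ₜ[k] f : A ⊗[k] A)
  have hff : (f ⊗ₜ[k] 1 : A ⊗[k] A) * (1 ⊗ₜ f) = f ⊗ₜ f := by simp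
  have hu : IsUnit (algebraMap (A ⊗[k] A) T (f ⊗ₜ 1) * algebraMap (A ⊗[k] A) T (1 ⊗ₜ f)) := by
    rw [← map_mul, hff]
    exact IsLocalization.Away.algebraMap_isUnit _
  let ι : A ⊗[k] A →ₐ[k] T := IsScalarTower.toAlgHom k (A ⊗[k] A) T
  let l : L →ₐ[k] T := IsLocalization.liftAlgHom (M := Submonoid.powers f)
    (f := ι.comp Algebra.TensorProduct.includeLeft) (by
      rintro ⟨_, n, rfl⟩
      rw [map_pow]
      exact (isUnit_of_mul_isUnit_left hu).pow n)
  let r : L →ₐ[k] T := IsLocalization.liftAlgHom (M := Submonoid.powers f)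
    (f := ι.comp Algebra.TensorProduct.includeRight) (by
      rintro ⟨_, n, rfl⟩
      rw [map_pow]
      exact (isUnit_of_mul_isUnit_right hu).pow n)
  have hl : ∀ a, l (algebraMap A L a) = algebraMap (A ⊗[k] A) T (a ⊗ₜ[k] (1 : A)) := fun a =>
    IsLocalization.lift_eq _ a
  have hr : ∀ a, r (algebraMap A L a) = algebraMap (A ⊗[k] A) T ((1 : A) ⊗ₜ[k] a) := fun a =>
    IsLocalization.lift_eq _ a
  let φ : L ⊗[k] L →ₐ[k] T := Algebra.TensorProduct.lift l r fun _ _ => Commute.all _ _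
  have hφ : ∀ a b, φ (a ⊗ₜ b) = l a * r b := fun a b => Algebra.TensorProduct.lift_tmul _ _ _ a b
  have hφι : ∀ s, φ (tensorSquareMap k A L s) = algebraMap _ T s := fun s => by
    induction s using TensorProduct.induction_on with
    | zero => simp
    | add y z hy hz => simp only [map_add, hy, hz]
    | tmul a b =>
      rw [tensorSquareMap_tmul, hφ, hl, hr, ← map_mul]
      simp
  let ψ : T →ₐ[k] L ⊗[k] L := IsLocalization.liftAlgHom
    (M := Submonoid.powers (f ⊗ₜ[k] f : A ⊗[k] A)) (f := tensorSquareMap k A L) (by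
      rintro ⟨_, n, rfl⟩
      rw [map_pow]
      exact (isUnit_tensorSquareMap f).pow n)
  have hψ : ∀ s, ψ (algebraMap _ T s) = tensorSquareMap k A L s := fun s =>
    IsLocalization.lift_eq _ s
  have h1 : ∀ y, φ (ψ y) = y := by
    have : (φ.comp ψ).toRingHom = RingHom.id T := by
      refine IsLocalization.ringHom_ext (Submonoid.powers (f ⊗ₜ[k] f : A ⊗[k] A)) ?_
      refine RingHom.ext fun s => ?_
      change φ (ψ (algebraMap (A ⊗[k] A) T s)) = algebraMap (A ⊗[k] A) T s
      rw [hψ, hφι]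
    exact fun y => DFunLike.congr_fun this y
  have h2 : ψ.comp φ = AlgHom.id k _ := by
    apply Algebra.TensorProduct.ext
    · refine AlgHom.coe_ringHom_injective (IsLocalization.ringHom_ext (Submonoid.powers f) ?_)
      ext a
      change ψ (φ (algebraMap A L a ⊗ₜ 1)) = algebraMap A L a ⊗ₜ 1
      rw [hφ, map_one, mul_one, hl, hψ, tensorSquareMap_tmul, map_one]
    · refine AlgHom.coe_ringHom_injective (IsLocalization.ringHom_ext (Submonoid.powers f) ?_)
      ext a
      change ψ (φ (1 ⊗ₜ algebraMap A L a)) = 1 ⊗ₜ algebraMap A L a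
      rw [hφ, map_one, one_mul, hr, hψ, tensorSquareMap_tmul, map_one]
  let e : T ≃ₐ[A ⊗[k] A] L ⊗[k] L :=
    { Equiv.ofBijective ψ (Function.bijective_iff_has_inverse.2
        ⟨φ, h1, fun y => DFunLike.congr_fun h2 y⟩) with
      map_mul' := map_mul ψ
      map_add' := map_add ψ
      commutes' := fun s => by
        rw [halg]
        exact hψ s }
  exact IsLocalization.isLocalization_of_algEquiv _ e

/-- A generator `1 ⊗ s - s ⊗ 1` with `s = a / f ^ n` becomes `f ^ n ⊗ a - a ⊗ f ^ n` after
multiplication by the unit `(f ⊗ f) ^ n`, and this comes from the diagonal ideal of `A`. -/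
theorem ker_lmul_le_map [Algebra (A ⊗[k] A) (L ⊗[k] L)]
    (halg : algebraMap (A ⊗[k] A) (L ⊗[k] L) = (tensorSquareMap k A L).toRingHom)
    (f : A) [IsLocalization.Away f L] :
    ideal k L ≤ (ideal k A).map (algebraMap (A ⊗[k] A) (L ⊗[k] L)) := by
  rw [← span_range_eq_ideal k L, Ideal.span_le]
  rintro _ ⟨s, rfl⟩
  obtain ⟨n, a, hs⟩ := IsLocalization.Away.surj f s
  have hu : IsUnit (algebraMap (A ⊗[k] A) (L ⊗[k] L) ((f ⊗ₜ f) ^ n)) := by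
    rw [map_pow, halg]
    exact (isUnit_tensorSquareMap f).pow n
  rw [SetLike.mem_coe, ← Ideal.unit_mul_mem_iff_mem _ hu]
  have e : algebraMap (A ⊗[k] A) (L ⊗[k] L) ((f ⊗ₜ f) ^ n) * (1 ⊗ₜ[k] s - s ⊗ₜ 1) =
      algebraMap (A ⊗[k] A) (L ⊗[k] L) ((f ^ n) ⊗ₜ a - a ⊗ₜ (f ^ n)) := by
    rw [halg]
    change tensorSquareMap k A L ((f ⊗ₜ f) ^ n) * _ = tensorSquareMap k A L _
    rw [Algebra.TensorProduct.tmul_pow, map_sub, tensorSquareMap_tmul, tensorSquareMap_tmul,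
      tensorSquareMap_tmul, mul_sub, Algebra.TensorProduct.tmul_mul_tmul,
      Algebra.TensorProduct.tmul_mul_tmul, mul_one, map_pow, ← hs, mul_comm s]
  change _ * (1 ⊗ₜ[k] s - s ⊗ₜ 1) ∈ _
  rw [e]
  refine Ideal.mem_map_of_mem _ ?_
  simp [ideal, RingHom.mem_ker, mul_comm]

end Chart

/-- Locally on a smooth algebra there are coordinates, with dual derivations, such that the diagonal
is a component of the subscheme cut out by the regular sequence of coordinate differences. -/
theorem exists_chart (k : Type u) [CommRing k] {A : Type v} [CommRing A] [Algebra k A]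
    [Algebra.Smooth k A] (p : Ideal A) [p.IsPrime] :
    ∃ f ∉ p, ∃ (N : ℕ) (a : Fin N → A) (δ : Fin N → Derivation k A (Localization.Away f)),
      (∀ i j, δ i (a j) = if i = j then 1 else 0) ∧
      ∃ (T : Type v) (_ : CommRing T) (_ : Algebra (A ⊗[k] A) T),
        IsLocalization.Away (f ⊗ₜ[k] f : A ⊗[k] A) T ∧
        ∃ x : Fin N → T, (∀ i, x i = algebraMap (A ⊗[k] A) T (a i ⊗ₜ 1 - 1 ⊗ₜ a i)) ∧
        (∀ (j : Fin N) (t : T), x j * t ∈ initialIdeal x j.val → t ∈ initialIdeal x j.val) ∧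
        (∃ μ : T →+* Localization.Away f, RingHom.ker μ ≤
            (KaehlerDifferential.ideal k A).map (algebraMap (A ⊗[k] A) T) ∧
          ∀ s, μ (algebraMap (A ⊗[k] A) T s) =
            algebraMap A _ (Algebra.TensorProduct.lmul' k s)) ∧
        ∃ t : T, (∀ s ∈ KaehlerDifferential.ideal k A,
          algebraMap (A ⊗[k] A) T s * t ∈ initialIdeal x N) ∧
          1 - t ∈ (KaehlerDifferential.ideal k A).map (algebraMap (A ⊗[k] A) T) := by
  obtain ⟨f, hf, N, a, b, hb⟩ := exists_basis_kaehlerDifferential k p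
  let L := Localization.Away f
  have : Algebra.Smooth A L := Algebra.Smooth.of_isLocalization_Away f
  have : Algebra.Smooth k L := Algebra.Smooth.comp k A L
  let : Algebra (MvPolynomial (Fin N) k) L :=
    (MvPolynomial.aeval fun i => algebraMap A L (a i)).toRingHom.toAlgebra
  have hX : ∀ i, algebraMap (MvPolynomial (Fin N) k) L (MvPolynomial.X i) = algebraMap A L (a i) :=
    fun i => MvPolynomial.aeval_X _ i
  have : IsScalarTower k (MvPolynomial (Fin N) k) L := IsScalarTower.of_algebraMap_eq fun c =>
    ((MvPolynomial.aeval fun i => algebraMap A L (a i)).commutes c).symm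
  have : Algebra.Etale (MvPolynomial (Fin N) k) L :=
    etale_of_basis_kaehlerDifferential b fun i => by rw [hb, hX]
  let : Algebra (A ⊗[k] A) (L ⊗[k] L) := (tensorSquareMap k A L).toRingHom.toAlgebra
  have halg : algebraMap (A ⊗[k] A) (L ⊗[k] L) = (tensorSquareMap k A L).toRingHom := rfl
  -- The dual derivations are the coordinate functions of the basis `da i`, composed with `d`; the
  -- ring `T` is `L ⊗ L`.
  refine ⟨f, hf, N, a, fun i => ((b.coord i).compDer (KaehlerDifferential.D k L)).compAlgebraMap A,
    fun i j => ?_, L ⊗[k] L, inferInstance, inferInstance, isLocalization_tensorSquare halg f,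
    coordDiff k N L, fun i => ?_, mem_of_coordDiff_mul_mem,
    ⟨(Algebra.TensorProduct.lmul' k (S := L)).toRingHom, ker_lmul_le_map halg f, fun s => ?_⟩, ?_⟩
  · change b.coord i (KaehlerDifferential.D k L (algebraMap A L (a j))) = _
    rw [← hb, Module.Basis.coord_apply, Module.Basis.repr_self, Finsupp.single_apply]
    simp only [eq_comm]
  · rw [coordDiff, hX, halg]
    change _ = tensorSquareMap k A L _
    rw [map_sub, tensorSquareMap_tmul, tensorSquareMap_tmul, map_one]
  · rw [halg]
    change Algebra.TensorProduct.lmul' k (tensorSquareMap k A L s) = _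
    induction s using TensorProduct.induction_on with
    | zero => simp
    | add y z hy hz => simp only [map_add, hy, hz]
    | tmul a b => rw [tensorSquareMap_tmul]; simp [L]
  · obtain ⟨t, ht, ht'⟩ := exists_diagonal_idempotent (k := k) (N := N) (L := L)
    refine ⟨t, fun s hs => ?_, ker_lmul_le_map halg f ?_⟩
    · rw [← KaehlerDifferential.span_range_eq_ideal k A] at hs
      induction hs using Submodule.span_induction with
      | mem s hs =>
        obtain ⟨c, rfl⟩ := hs
        have := ht (algebraMap A L c)
        rw [halg]
        change tensorSquareMap k A L _ * _ ∈ _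
        rwa [map_sub, tensorSquareMap_tmul, tensorSquareMap_tmul, map_one]
      | zero => simp
      | add x y _ _ hx hy =>
        rw [map_add, add_mul]
        exact add_mem hx hy
      | smul c x _ hx =>
        rw [smul_eq_mul, map_mul, mul_assoc]
        exact Ideal.mul_mem_left _ _ hx
    · change Algebra.TensorProduct.lmul' k (1 - t) = 0
      rw [map_sub, ht', map_one, sub_self]

end HochschildHKR
end

noncomputable section

namespace HochschildHKR

universe u v

/-! ### Pairing chains with derivations -/

section DerivationPairing

variable {k : Type u} [CommRing k] {A : Type v} [CommRing A] [Algebra k A]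
  {B : Type*} [CommRing B] [Algebra k B] [Algebra A B] [IsScalarTower k A B]

/-- The linear form `a₀ ⊗ a₁ ⊗ ⋯ ⊗ a_n ↦ a₀ D₁(a₁) ⋯ D_n(a_n)` on Hochschild chains. -/
def derPairing {n : ℕ} (D : Fin n → Derivation k A B) : Chains k A n →ₗ[k] B :=
  PiTensorProduct.lift ((MultilinearMap.mkPiAlgebra k (Fin (n + 1)) B).compLinearMap
    (Fin.cons (IsScalarTower.toAlgHom k A B).toLinearMap fun i => (D i : A →ₗ[k] B) :
      Fin (n + 1) → (A →ₗ[k] B)))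

theorem derPairing_tprod {n : ℕ} (D : Fin n → Derivation k A B) (a : Fin (n + 1) → A) :
    derPairing D (PiTensorProduct.tprod k a) = algebraMap A B (a 0) * ∏ i, D i (a i.succ) := by
  simp [derPairing, Fin.prod_univ_succ]

theorem derPairing_incl_mul {n : ℕ} (D : Fin n → Derivation k A B) (c : A) (z : Chains k A n) :
    derPairing D (incl k (0 : Fin (n + 1)) c * z) = algebraMap A B c * derPairing D z := by
  refine tensorPower_induction (k := k) (A := A)
    (p := fun z => derPairing D (incl k (0 : Fin (n + 1)) c * z) =
      algebraMap A B c * derPairing D z) z (fun a => ?_) (fun r x hx => ?_) (fun x y hx hy => ?_)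
  · rw [incl_apply, PiTensorProduct.tprod_mul_tprod, derPairing_tprod, derPairing_tprod]
    simp [Pi.mulSingle_eq_of_ne, mul_assoc]
  · rw [mul_smul_comm, map_smul, map_smul, hx, mul_smul_comm]
  · rw [mul_add, map_add, map_add, hx, hy, mul_add]

theorem prod_fiber_face_zero {n : ℕ} (a : Fin (n + 2) → A) :
    (fun j => ∏ l with face n 0 l = j, a l) = Fin.cons (a 0 * a 1) fun j => a j.succ.succ := by
  funext j
  induction j using Fin.cases with
  | zero =>
    rw [Fin.cons_zero, ← Finset.prod_pair (f := a) (a := 0) (b := 1) (by simp)]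
    refine Finset.prod_congr ?_ fun _ _ => rfl
    ext l
    have := l.isLt
    simp only [face, Finset.mem_filter, Finset.mem_univ, true_and, Finset.mem_insert,
      Finset.mem_singleton, Fin.ext_iff, Fin.val_zero, Fin.val_one]
    grind
  | succ j =>
    have := j.isLt
    rw [Fin.cons_succ, ← Finset.prod_singleton a j.succ.succ]
    refine Finset.prod_congr ?_ fun _ _ => rfl
    ext l
    have := l.isLt
    simp only [face, Finset.mem_filter, Finset.mem_univ, true_and,
      Finset.mem_singleton, Fin.ext_iff, Fin.val_zero, Fin.val_succ]
    grind

theorem prod_fiber_face_last {n : ℕ} (a : Fin (n + 2) → A) :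
    (fun j => ∏ l with face n (Fin.last (n + 1)) l = j, a l) =
      Fin.cons (a 0 * a (Fin.last (n + 1))) fun j => a j.succ.castSucc := by
  funext j
  induction j using Fin.cases with
  | zero =>
    rw [Fin.cons_zero, ← Finset.prod_pair (f := a) (a := 0) (b := Fin.last (n + 1)) (by
      simp [Fin.ext_iff])]
    refine Finset.prod_congr ?_ fun _ _ => rfl
    ext l
    have := l.isLt
    simp only [face, Finset.mem_filter, Finset.mem_univ, true_and, Finset.mem_insert,
      Finset.mem_singleton, Fin.ext_iff, Fin.val_zero, Fin.val_last]
    grind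
  | succ j =>
    have := j.isLt
    rw [Fin.cons_succ, ← Finset.prod_singleton a j.succ.castSucc]
    refine Finset.prod_congr ?_ fun _ _ => rfl
    ext l
    have := l.isLt
    simp only [face, Finset.mem_filter, Finset.mem_univ, true_and,
      Finset.mem_singleton, Fin.ext_iff, Fin.val_last, Fin.val_succ, Fin.val_castSucc]
    grind

theorem prod_fiber_face_succ {n : ℕ} (p : Fin n) (a : Fin (n + 2) → A) :
    (fun j => ∏ l with face n p.succ.castSucc l = j, a l) = Fin.cons (a 0)
      fun j => if j = p then a j.castSucc.succ * a j.succ.succ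
        else a (p.castSucc.succAbove j).succ := by
  funext j
  induction j using Fin.cases with
  | zero =>
    rw [Fin.cons_zero, ← Finset.prod_singleton a 0]
    refine Finset.prod_congr ?_ fun _ _ => rfl
    ext l
    have := l.isLt
    simp only [face, Finset.mem_filter, Finset.mem_univ, true_and,
      Finset.mem_singleton, Fin.ext_iff, Fin.val_zero, Fin.val_succ, Fin.val_castSucc]
    grind
  | succ j =>
    have := j.isLt
    rw [Fin.cons_succ]
    split_ifs with h
    · subst h
      rw [← Finset.prod_pair (f := a) (a := j.castSucc.succ) (b := j.succ.succ) (by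
        simp [Fin.ext_iff])]
      refine Finset.prod_congr ?_ fun _ _ => rfl
      ext l
      have := l.isLt
      simp only [face, Finset.mem_filter, Finset.mem_univ, true_and, Finset.mem_insert,
        Finset.mem_singleton, Fin.ext_iff, Fin.val_succ, Fin.val_castSucc]
      grind
    · rw [← Finset.prod_singleton a (p.castSucc.succAbove j).succ]
      refine Finset.prod_congr ?_ fun _ _ => rfl
      rw [Fin.ext_iff] at h
      ext l
      have := l.isLt
      simp only [face, Finset.mem_filter, Finset.mem_univ, true_and, Fin.succAbove, Fin.lt_def,
        Finset.mem_singleton, Fin.ext_iff, apply_ite Fin.val, Fin.val_succ, Fin.val_castSucc]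
      grind

/-- The linear forms given by derivations vanish on boundaries. -/
theorem derPairing_hochschildB {n : ℕ} (D : Fin n → Derivation k A B) (z : Chains k A (n + 1)) :
    derPairing D (hochschildB k A n z) = 0 := by
  refine tensorPower_induction (k := k) (A := A)
    (p := fun z => derPairing D (hochschildB k A n z) = 0) z (fun a => ?_) (fun r x hx => ?_)
    (fun x y hx hy => ?_)
  · let t : Fin (n + 1) → B := fun i => algebraMap A B (a 0) * (algebraMap A B (a i.succ) *
      ∏ l, D l (a (i.succAbove l).succ))
    let w : Fin (n + 1) → B := fun i => (-1 : k) ^ i.val • t i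
    have h0 : derPairing D (push k (face n 0) (PiTensorProduct.tprod k a)) = t 0 := by
      rw [push_tprod, prod_fiber_face_zero, derPairing_tprod]
      simp [t, mul_assoc]
    have hl : derPairing D (push k (face n (Fin.last (n + 1))) (PiTensorProduct.tprod k a)) =
        t (Fin.last n) := by
      rw [push_tprod, prod_fiber_face_last, derPairing_tprod]
      simp [t, mul_assoc]
    have hs : ∀ p : Fin n, derPairing D (push k (face n p.succ.castSucc)
        (PiTensorProduct.tprod k a)) = t p.castSucc + t p.succ := fun p => by
      rw [push_tprod, prod_fiber_face_succ, derPairing_tprod, Fin.cons_zero]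
      simp only [Fin.cons_succ, t]
      rw [← Finset.mul_prod_erase Finset.univ _ (Finset.mem_univ p),
        ← Finset.mul_prod_erase Finset.univ (fun l => D l (a (p.castSucc.succAbove l).succ))
          (Finset.mem_univ p),
        ← Finset.mul_prod_erase Finset.univ (fun l => D l (a (p.succ.succAbove l).succ))
          (Finset.mem_univ p)]
      have e1 : ∏ l ∈ Finset.univ.erase p, D l (if l = p then a l.castSucc.succ * a l.succ.succ
          else a (p.castSucc.succAbove l).succ) =
          ∏ l ∈ Finset.univ.erase p, D l (a (p.castSucc.succAbove l).succ) :=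
        Finset.prod_congr rfl fun l hl => by rw [if_neg (Finset.ne_of_mem_erase hl)]
      have e2 : ∏ l ∈ Finset.univ.erase p, D l (a (p.succ.succAbove l).succ) =
          ∏ l ∈ Finset.univ.erase p, D l (a (p.castSucc.succAbove l).succ) :=
        Finset.prod_congr rfl fun l hl => by
          have := Finset.ne_of_mem_erase hl
          rw [Ne, Fin.ext_iff] at this
          congr 3
          simp only [Fin.succAbove, Fin.lt_def, Fin.ext_iff, Fin.val_succ, Fin.val_castSucc]
          split_ifs <;> simp only [Fin.val_succ, Fin.val_castSucc] <;> omega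
      rw [e1, e2, if_pos rfl, Derivation.leibniz, Algebra.smul_def, Algebra.smul_def,
        Fin.succAbove_castSucc_self, Fin.succAbove_succ_self]
      ring
    have hw : ∀ p : Fin n, (-1 : k) ^ (p.val + 1) • (t p.castSucc + t p.succ) =
        w p.succ - w p.castSucc := fun p => by
      simp only [w, Fin.val_succ, Fin.val_castSucc, pow_succ, smul_add]
      simp
      abel
    have hsum := (Fin.sum_univ_succ w).symm.trans (Fin.sum_univ_castSucc w)
    rw [hochschildB, linearMap_sum_apply, map_sum, Fin.sum_univ_castSucc, Fin.sum_univ_succ]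
    simp only [LinearMap.smul_apply, map_smul, Fin.castSucc_zero, h0, hl, hs, Fin.val_castSucc,
      Fin.val_succ, hw, Finset.sum_sub_distrib, Fin.val_last, Fin.val_zero, pow_zero, one_smul]
    have hl' : (-1 : k) ^ (n + 1) • t (Fin.last n) = - w (Fin.last n) := by
      simp [w, pow_succ]
    have h0' : t 0 = w 0 := by simp [w]
    rw [hl', h0']
    linear_combination hsum
  · rw [map_smul, map_smul, hx, smul_zero]
  · rw [map_add, map_add, hx, hy, add_zero]

/-- The sum over `σ` is the Leibniz expansion of the determinant, each permutation occurring once.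
-/
theorem derPairing_antisymmetrization {n : ℕ} (D : Fin n → Derivation k A B) (a₀ : A)
    (a : Fin n → A) : derPairing D (antisymmetrization k a₀ a) =
      algebraMap A B a₀ * (Matrix.of fun i j => D j (a i)).det := by
  rw [antisymmetrization, map_sum, Matrix.det_apply, Finset.mul_sum]
  refine Finset.sum_congr rfl fun σ _ => ?_
  rw [Units.smul_def, map_zsmul, derPairing_tprod, ← Units.smul_def, mul_smul_comm]
  simp

/-- A nonzero term forces `K = I ∘ σ`. As both are decreasing, `σ` is increasing, hence the
identity. -/
theorem det_dual {n N : ℕ} {K I : Fin n → Fin N} (hK : StrictAnti K) (hI : StrictAnti I) :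
    (Matrix.of fun i j => if K j = I i then (1 : B) else 0).det = if K = I then 1 else 0 := by
  split_ifs with h
  · subst h
    rw [← Matrix.det_one (n := Fin n)]
    congr 1
    ext i j
    simp [Matrix.one_apply, hK.injective.eq_iff, eq_comm]
  · rw [Matrix.det_apply]
    refine Finset.sum_eq_zero fun σ _ => ?_
    by_contra hne
    have hall : ∀ i, K i = I (σ i) := fun i => by
      by_contra hi
      refine hne ?_
      rw [Finset.prod_eq_zero (Finset.mem_univ i) (by simp [hi]), smul_zero]
    have hσ : StrictMono σ := fun i j hij => by
      have := hK hij
      rwa [hall, hall, hI.lt_iff_gt] at this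
    have : σ = 1 := by
      have e := Subsingleton.elim (hσ.orderIsoOfSurjective σ σ.surjective) (OrderIso.refl _)
      ext i
      exact congrArg Fin.val (DFunLike.congr_fun e i)
    exact h (funext fun i => by rw [hall, this]; rfl)

end DerivationPairing

end HochschildHKR
end

noncomputable section

namespace HochschildHKR

universe u v

/-! ### Generation of the homology over a chart -/

section BaseChange

open Submodule

variable {k : Type u} [Field k] {A : Type v} [CommRing A] [Algebra k A]
  {T : Type v} [CommRing T] [Algebra (A ⊗[k] A) T]

theorem tmul_mem_smul_top {S M : Type*} [CommRing S] [AddCommGroup M] [Module S M]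
    {T : Type*} [CommRing T] [Algebra S T] (J : Ideal S) {m : M}
    (hm : m ∈ (J • ⊤ : Submodule S M)) :
    (1 : T) ⊗ₜ[S] m ∈ (J.map (algebraMap S T) • ⊤ : Submodule T (T ⊗[S] M)) := by
  induction hm using Submodule.smul_induction_on' with
  | smul r hr m _ =>
    rw [TensorProduct.tmul_smul, ← algebraMap_smul T r]
    exact smul_mem_smul (Ideal.mem_map_of_mem _ hr) trivial
  | add x _ y _ hx hy =>
    rw [TensorProduct.tmul_add]
    exact add_mem hx hy

theorem mem_of_localized {S M : Type*} [CommRing S] [AddCommGroup M] [Module S M]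
    {T : Type*} [CommRing T] [Algebra S T] (g : S) [IsLocalization.Away g T]
    (P : Submodule S M) (m : M) (hm : P.mkQ.baseChange T (1 ⊗ₜ m) = 0) :
    ∃ r : ℕ, g ^ r • m ∈ P := by
  have h : TensorProduct.mk S T (M ⧸ P) 1 (P.mkQ m) = 0 := hm
  rw [IsLocalizedModule.eq_zero_iff (Submonoid.powers g)] at h
  obtain ⟨⟨_, r, rfl⟩, h⟩ := h
  refine ⟨r, ?_⟩
  rw [← Submodule.ker_mkQ P, LinearMap.mem_ker, map_smul]
  exact h

variable (k A) in
/-- Chains on the bar complex whose image in the Hochschild complex is a cycle. -/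
theorem barD_mem_of_closeUp_mem_cycles {n : ℕ} {z : Bar k A (n + 1)}
    (hz : closeUp k A (n + 1) z ∈ cycles k A (n + 1)) : barD k A n z ∈
      (KaehlerDifferential.ideal k A • ⊤ : Submodule (A ⊗[k] A) (Bar k A n)) := by
  rw [← closeUp_eq_zero_iff, ← hochschildB_closeUp]
  exact hz

variable {N : ℕ} (a : Fin N → A) (x : Fin N → T)

/-- The Koszul argument works modulo the coordinate ideal, whereas `z` is a cycle only modulo the
larger diagonal ideal. Multiplication by `t` carries the diagonal ideal into the coordinate ideal,
so the argument applies to `t • z`; the rest, `(1 - t) • z`, is a multiple of the diagonal ideal. -/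
theorem one_tmul_mem_span [Module.Flat (A ⊗[k] A) T]
    (hx : ∀ i, x i = algebraMap (A ⊗[k] A) T (a i ⊗ₜ 1 - 1 ⊗ₜ a i))
    (hreg : ∀ (j : Fin N) (t : T), x j * t ∈ initialIdeal x j.val → t ∈ initialIdeal x j.val)
    (t : T) (ht : ∀ s ∈ KaehlerDifferential.ideal k A,
      algebraMap (A ⊗[k] A) T s * t ∈ initialIdeal x N)
    (ht' : 1 - t ∈ (KaehlerDifferential.ideal k A).map (algebraMap (A ⊗[k] A) T))
    {n : ℕ} {z : Bar k A n} (hz : closeUp k A n z ∈ cycles k A n) :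
    (1 : T) ⊗ₜ[A ⊗[k] A] z ∈ span T ((fun I : Fin n → Fin N =>
        (1 : T) ⊗ₜ[A ⊗[k] A] antisymBar k (a ∘ I)) '' decreasing N N n) ⊔
      LinearMap.range ((barD k A n).baseChange T) ⊔
      (KaehlerDifferential.ideal k A).map (algebraMap (A ⊗[k] A) T) • ⊤ := by
  have hflat : ∀ n, Module.Flat (A ⊗[k] A) (Bar k A n) := flat_bar k A
  have hflat' : ∀ n, Module.Flat T (T ⊗[A ⊗[k] A] Bar k A n) := fun n => inferInstance
  have hle : initialIdeal x N ≤
      (KaehlerDifferential.ideal k A).map (algebraMap (A ⊗[k] A) T) := by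
    rw [initialIdeal, Ideal.span_le]
    rintro _ ⟨i, -, rfl⟩
    rw [hx]
    exact Ideal.mem_map_of_mem _ (tmul_sub_mem_ideal k A (a i))
  have key := mem_generated (fun n => T ⊗[A ⊗[k] A] Bar k A n)
    (fun n => (barD k A n).baseChange T) x
    (fun n I => (1 : T) ⊗ₜ[A ⊗[k] A] antisymBar k (a ∘ I)) ?_ ?_ ?_ ?_ hreg N le_rfl
  · have hmem : t • ((1 : T) ⊗ₜ[A ⊗[k] A] z) ∈ generated (fun n => T ⊗[A ⊗[k] A] Bar k A n)
        (fun n => (barD k A n).baseChange T) x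
        (fun n I => (1 : T) ⊗ₜ[A ⊗[k] A] antisymBar k (a ∘ I)) N n := by
      cases n with
      | zero => exact key.1 _
      | succ n =>
        refine key.2 n _ ?_
        rw [map_smul, LinearMap.baseChange_tmul]
        have := tmul_mem_smul_top (T := T) _ (barD_mem_of_closeUp_mem_cycles k A hz)
        refine (?_ : ∀ y ∈ ((KaehlerDifferential.ideal k A).map (algebraMap (A ⊗[k] A) T) • ⊤ :
          Submodule T (T ⊗[A ⊗[k] A] Bar k A n)), t • y ∈ initialIdeal x N •
            (⊤ : Submodule T (T ⊗[A ⊗[k] A] Bar k A n))) _ this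
        intro y hy
        have hJ : ∀ r ∈ (KaehlerDifferential.ideal k A).map (algebraMap (A ⊗[k] A) T),
            t * r ∈ initialIdeal x N := by
          intro r hr
          induction hr using Submodule.span_induction with
          | mem r hr =>
            obtain ⟨s, hs, rfl⟩ := hr
            rw [mul_comm]
            exact ht s hs
          | zero => simp
          | add r s _ _ hr hs =>
            rw [mul_add]
            exact add_mem hr hs
          | smul c r _ hr =>
            rw [smul_eq_mul, mul_left_comm]
            exact Ideal.mul_mem_left _ _ hr
        induction hy using Submodule.smul_induction_on' with
        | smul r hr m _ =>
          rw [← mul_smul]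
          exact smul_mem_smul (hJ r hr) trivial
        | add y _ y' _ h h' =>
          rw [smul_add]
          exact add_mem h h'
    have e : (1 : T) ⊗ₜ[A ⊗[k] A] z =
        t • ((1 : T) ⊗ₜ[A ⊗[k] A] z) + (1 - t) • ((1 : T) ⊗ₜ[A ⊗[k] A] z) := by
      rw [← add_smul, add_sub_cancel, one_smul]
    rw [e]
    have hle' := sup_le_sup_left (smul_mono hle (le_refl (⊤ : Submodule T (T ⊗[A ⊗[k] A] Bar k A n))))
      (span T ((fun I : Fin n → Fin N => (1 : T) ⊗ₜ[A ⊗[k] A] antisymBar k (a ∘ I)) ''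
        decreasing N N n) ⊔ LinearMap.range ((barD k A n).baseChange T))
    refine add_mem (hle' hmem) (mem_sup_right ?_)
    exact smul_mem_smul ht' trivial
  · intro n y
    induction y using TensorProduct.induction_on with
    | zero => simp
    | add y y' h h' => rw [map_add, map_add, h, h', add_zero]
    | tmul c y =>
      rw [LinearMap.baseChange_tmul, LinearMap.baseChange_tmul, barD_barD, TensorProduct.tmul_zero]
  · intro n y hy
    have hex : Function.Exact (barD k A (n + 1)) (barD k A n) := fun z =>
      ⟨exists_barD_eq k A n z, by rintro ⟨y, rfl⟩; exact barD_barD k A n y⟩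
    exact (Module.Flat.lTensor_exact T hex y).1 hy
  · intro I
    simp only [antisymBar_zero]
    have h := Submodule.baseChange_span (R := A ⊗[k] A) (A := T) {(1 : Bar k A 0)}
    rw [span_one_bar_zero, Submodule.baseChange_top, Set.image_singleton] at h
    exact h.symm
  · intro n I
    rw [LinearMap.baseChange_tmul, barD_antisymBar, TensorProduct.tmul_sum]
    refine Finset.sum_congr rfl fun i _ => ?_
    rw [TensorProduct.tmul_smul, TensorProduct.tmul_smul, ← algebraMap_smul T ((-1 : A ⊗[k] A) ^ i.val),
      ← algebraMap_smul T (_ - _), map_pow, map_neg, map_one, hx]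
    rfl

end BaseChange

/-! ### Passing from charts to the whole of `Spec A` -/

section LocalToGlobal

open Submodule

variable {k : Type u} [CommRing k] {A : Type v} [CommRing A] [Algebra k A]

/-- A submodule of a module over `A ⊗ A` which contains the multiples of the diagonal ideal can be
described locally on `Spec A`. -/
theorem mem_of_forall_prime {M : Type*} [AddCommGroup M] [Module (A ⊗[k] A) M]
    (P : Submodule (A ⊗[k] A) M) (hP : KaehlerDifferential.ideal k A • ⊤ ≤ P) (m : M)
    (h : ∀ p : Ideal A, p.IsPrime → ∃ f ∉ p, ∃ r : ℕ, (f ⊗ₜ[k] f : A ⊗[k] A) ^ r • m ∈ P) :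
    m ∈ P := by
  -- The quotient by `P` is killed by the diagonal ideal, so it is an `A`-module; `J` is the
  -- annihilator in `A` of the class of `m`. Modulo the diagonal ideal `(f ⊗ f) ^ r` acts as `f ^ (r
  -- + r)`, so `J` lies in no maximal ideal.
  let J : Ideal A := Ideal.comap (I := P.comap (LinearMap.toSpanSingleton (A ⊗[k] A) M m))
    (Algebra.TensorProduct.includeLeftRingHom : A →+* A ⊗[k] A)
  have hJ : ∀ c : A, c ∈ J ↔ (c ⊗ₜ[k] (1 : A)) • m ∈ P := fun c => Iff.rfl
  have htop : J = ⊤ := by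
    by_contra hne
    obtain ⟨p, hp, hle⟩ := Ideal.exists_le_maximal J hne
    obtain ⟨f, hf, r, hr⟩ := h p hp.isPrime
    refine hf (hp.isPrime.mem_of_pow_mem (r + r) (hle ?_))
    rw [hJ]
    have e : ((f ^ (r + r)) ⊗ₜ[k] (1 : A)) • m = (f ⊗ₜ[k] f : A ⊗[k] A) ^ r • m +
        ((f ^ (r + r)) ⊗ₜ[k] (1 : A) - (f ⊗ₜ[k] f : A ⊗[k] A) ^ r) • m := by
      rw [← add_smul, add_sub_cancel]
    rw [e]
    refine add_mem hr (hP (smul_mem_smul ?_ trivial))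
    simp [KaehlerDifferential.ideal, RingHom.mem_ker, pow_add]
  have h1 : (1 : A) ∈ J := htop ▸ trivial
  rw [hJ] at h1
  simpa [← Algebra.TensorProduct.one_def] using h1

/-- By finite presentation of the differentials, a derivation into `L` becomes one into `A` after
multiplication by a power of `f`. The pairing is multilinear in the derivations and the denominators
are units in `L`. -/
theorem derPairing_localization {n : ℕ} (f : A) (L : Type*) [CommRing L] [Algebra A L] [Algebra k L]
    [IsScalarTower k A L] [IsLocalization.Away f L] [Module.FinitePresentation A (Ω[A⁄k])]
    {z : Chains k A n} (hz : ∀ D : Fin n → Derivation k A A, derPairing D z = 0)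
    (δ : Fin n → Derivation k A L) : derPairing δ z = 0 := by
  have hex : ∀ i, ∃ (D : Derivation k A A) (s : Submonoid.powers f),
      ∀ a, algebraMap A L (D a) = algebraMap A L s * δ i a := fun i => by
    obtain ⟨h, s, hs⟩ := Module.FinitePresentation.exists_lift_of_isLocalizedModule
      (Submonoid.powers f) (Algebra.linearMap A L) (δ i).liftKaehlerDifferential
    refine ⟨h.compDer (KaehlerDifferential.D k A), s, fun a => ?_⟩
    have := LinearMap.congr_fun hs (KaehlerDifferential.D k A a)
    simpa [Submonoid.smul_def, Algebra.smul_def] using this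
  choose D s hD using hex
  have h : algebraMap A L (derPairing D z) =
      algebraMap A L ((∏ i, s i : Submonoid.powers f) : A) * derPairing δ z := by
    clear hz
    refine tensorPower_induction (k := k) (A := A)
      (p := fun z => algebraMap A L (derPairing D z) =
        algebraMap A L ((∏ i, s i : Submonoid.powers f) : A) * derPairing δ z) z
      (fun a => ?_) (fun r x hx => ?_) (fun x y hx hy => ?_)
    · rw [derPairing_tprod, derPairing_tprod, map_mul, map_prod]
      simp only [hD, Finset.prod_mul_distrib, Submonoid.coe_finsetProd, map_prod]
      rw [Algebra.algebraMap_self, RingHom.id_apply]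
      ring
    · rw [LinearMap.map_smul, LinearMap.map_smul, mul_smul_comm, ← hx, Algebra.smul_def, map_mul,
        ← IsScalarTower.algebraMap_apply, ← Algebra.smul_def]
    · rw [map_add, map_add, map_add, hx, hy, mul_add]
  rw [hz, map_zero] at h
  exact (IsLocalization.map_units L (∏ i, s i)).mul_right_eq_zero.1 h.symm

end LocalToGlobal

end HochschildHKR
end

noncomputable section

namespace HochschildHKR

universe u v

/-! ### Cycles are antisymmetrizations up to boundaries -/

section Generation

open Submodule

theorem baseChange_quotient_eq_zero {S M : Type*} [CommRing S] [AddCommGroup M] [Module S M]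
    {T : Type*} [CommRing T] [Algebra S T] {J : Ideal S} {P : Submodule S M} (hP : J • ⊤ ≤ P)
    {r : T} (hr : r ∈ J.map (algebraMap S T)) (y : T ⊗[S] (M ⧸ P)) : r • y = 0 := by
  induction hr using Submodule.span_induction with
  | mem r hr =>
    obtain ⟨s, hs, rfl⟩ := hr
    induction y using TensorProduct.induction_on with
    | zero => rw [smul_zero]
    | add y y' h h' => rw [smul_add, h, h', add_zero]
    | tmul c y =>
      obtain ⟨m, rfl⟩ := P.mkQ_surjective y
      have : P.mkQ (s • m) = 0 := by
        rw [← LinearMap.mem_ker, ker_mkQ]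
        exact hP (smul_mem_smul hs trivial)
      rw [algebraMap_smul, ← TensorProduct.tmul_smul, ← map_smul, this, TensorProduct.tmul_zero]
  | zero => rw [zero_smul]
  | add r s _ _ hr hs => rw [add_smul, hr, hs, add_zero]
  | smul c r _ hr => rw [smul_eq_mul, mul_smul, hr, smul_zero]

theorem range_sup_le_ker_baseChange {S M M' : Type*} [CommRing S] [AddCommGroup M] [Module S M]
    [AddCommGroup M'] [Module S M'] {T : Type*} [CommRing T] [Algebra S T] {J : Ideal S}
    (d : M' →ₗ[S] M) {P : Submodule S M} (hd : LinearMap.range d ≤ P) (hP : J • ⊤ ≤ P) :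
    LinearMap.range (d.baseChange T) ⊔ J.map (algebraMap S T) • ⊤ ≤
      LinearMap.ker (P.mkQ.baseChange T) := by
  refine sup_le ?_ (smul_le.2 fun r hr y _ => ?_)
  · rintro _ ⟨y, rfl⟩
    induction y using TensorProduct.induction_on with
    | zero => simp
    | add y y' h h' => rw [map_add]; exact add_mem h h'
    | tmul c y =>
      have : P.mkQ (d y) = 0 := by
        rw [← LinearMap.mem_ker, ker_mkQ]
        exact hd ⟨y, rfl⟩
      rw [LinearMap.mem_ker, LinearMap.baseChange_tmul, LinearMap.baseChange_tmul, this,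
        TensorProduct.tmul_zero]
  · rw [LinearMap.mem_ker, map_smul, baseChange_quotient_eq_zero hP hr]

/-- Hochschild cycles of a smooth algebra are antisymmetrizations up to boundaries. -/
theorem mem_span_antisymBar {k : Type u} [Field k] {A : Type v} [CommRing A] [Algebra k A]
    [Algebra.Smooth k A] {n : ℕ} {z : Bar k A n} (hz : closeUp k A n z ∈ cycles k A n) :
    z ∈ span (A ⊗[k] A) (Set.range (antisymBar k : (Fin n → A) → Bar k A n)) ⊔
      (LinearMap.range (barD k A n) ⊔ KaehlerDifferential.ideal k A • ⊤) := by
  refine mem_of_forall_prime _ (le_sup_right.trans le_sup_right) z fun p hp => ?_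
  obtain ⟨f, hf, N, a, δ, -, T, _, _, _, x, hx, hreg, -, t, ht, ht'⟩ := exists_chart k p
  have : Module.Flat (A ⊗[k] A) T :=
    IsLocalization.flat T (Submonoid.powers (f ⊗ₜ[k] f : A ⊗[k] A))
  refine ⟨f, hf, mem_of_localized (T := T) _ _ z ?_⟩
  have h := one_tmul_mem_span a x hx hreg t ht ht' hz
  rw [sup_assoc] at h
  rw [← LinearMap.mem_ker]
  refine (?_ : _ ≤ LinearMap.ker _) h
  refine sup_le ?_ (range_sup_le_ker_baseChange _ (le_sup_left.trans le_sup_right)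
    (le_sup_right.trans le_sup_right))
  rw [span_le]
  rintro _ ⟨I, -, rfl⟩
  rw [SetLike.mem_coe, LinearMap.mem_ker, LinearMap.baseChange_tmul, mkQ_apply,
    (Submodule.Quotient.mk_eq_zero _).2 (mem_sup_left (subset_span (Set.mem_range_self _))), TensorProduct.tmul_zero]

end Generation

/-! ### Cycles with vanishing pairings are boundaries -/

section Detection

open Submodule

variable {k : Type u} [Field k] {A : Type v} [CommRing A] [Algebra k A]
  {T : Type v} [CommRing T] [Algebra (A ⊗[k] A) T] {L : Type v} [CommRing L] [Algebra A L]
  [Algebra k L] [IsScalarTower k A L] [Algebra T L] [Algebra (A ⊗[k] A) L]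
  [IsScalarTower (A ⊗[k] A) T L]

/-- The linear form on the bar complex given by derivations. -/
def barPairing (hS : ∀ s : A ⊗[k] A, algebraMap (A ⊗[k] A) L s =
      algebraMap A L (Algebra.TensorProduct.lmul' k s))
    {n : ℕ} (D : Fin n → Derivation k A L) : Bar k A n →ₗ[A ⊗[k] A] L where
  toFun z := derPairing D (closeUp k A n z)
  map_add' y z := by rw [map_add, map_add]
  map_smul' s z := by
    rw [closeUp_smul, derPairing_incl_mul, RingHom.id_apply, Algebra.smul_def, hS]

/-- Expand `1 ⊗ z` in antisymmetrizations of coordinates. Pairing with the dual derivations indexed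
by `K` extracts the image in `L` of the coefficient of `K`; it vanishes, so the coefficient lies in
the diagonal ideal, which kills the quotient. -/
theorem baseChange_one_tmul_eq_zero (hS : ∀ s : A ⊗[k] A, algebraMap (A ⊗[k] A) L s =
      algebraMap A L (Algebra.TensorProduct.lmul' k s))
    (hker : ∀ c : T, algebraMap T L c = 0 →
      c ∈ (KaehlerDifferential.ideal k A).map (algebraMap (A ⊗[k] A) T))
    {N : ℕ} (a : Fin N → A) (δ : Fin N → Derivation k A L)
    (hδ : ∀ i j, δ i (a j) = if i = j then 1 else 0) {n : ℕ} {z : Bar k A n}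
    (hspan : (1 : T) ⊗ₜ[A ⊗[k] A] z ∈ span T ((fun I : Fin n → Fin N =>
        (1 : T) ⊗ₜ[A ⊗[k] A] antisymBar k (a ∘ I)) '' decreasing N N n) ⊔
      (LinearMap.range ((barD k A n).baseChange T) ⊔
      (KaehlerDifferential.ideal k A).map (algebraMap (A ⊗[k] A) T) • ⊤))
    (hz : ∀ D : Fin n → Derivation k A L, derPairing D (closeUp k A n z) = 0) :
    (LinearMap.range (barD k A n) ⊔ KaehlerDifferential.ideal k A • ⊤).mkQ.baseChange T
      (1 ⊗ₜ z) = 0 := by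
  obtain ⟨y, hy, w, hw, e⟩ := mem_sup.1 hspan
  obtain ⟨c, hc, rfl⟩ := (Finsupp.mem_span_image_iff_linearCombination T).1 hy
  rw [Finsupp.mem_supported] at hc
  have hcoef : ∀ K ∈ c.support, c K ∈
      (KaehlerDifferential.ideal k A).map (algebraMap (A ⊗[k] A) T) := fun K hK => by
    let R : T ⊗[A ⊗[k] A] Bar k A n →ₗ[T] L :=
      (barPairing hS fun i => δ (K i)).liftBaseChange T
    have hR : ∀ (c : T) (y : Bar k A n), R (c ⊗ₜ y) =
        c • derPairing (fun i => δ (K i)) (closeUp k A n y) := fun c y =>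
      LinearMap.liftBaseChange_tmul _ _ _ _
    have hRη : ∀ I ∈ c.support, R (1 ⊗ₜ antisymBar k (a ∘ I)) = if K = I then 1 else 0 := by
      intro I hI
      rw [hR, one_smul, ← det_dual (hc hK).1 (hc hI).1, ← one_smul (A ⊗[k] A) (antisymBar k _),
        closeUp_smul_antisymBar, derPairing_antisymmetrization, map_one, map_one, one_mul]
      simp only [Function.comp, hδ]
    have hRw : R w = 0 := by
      refine (?_ : _ ≤ LinearMap.ker R) hw
      refine sup_le ?_ (smul_le.2 fun r hr y _ => ?_)
      · rintro _ ⟨y, rfl⟩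
        induction y using TensorProduct.induction_on with
        | zero => simp
        | add y y' h h' => rw [map_add]; exact add_mem h h'
        | tmul c y =>
          rw [LinearMap.mem_ker, LinearMap.baseChange_tmul, hR, ← hochschildB_closeUp,
            derPairing_hochschildB, smul_zero]
      · rw [LinearMap.mem_ker, map_smul, Algebra.smul_def]
        have : algebraMap T L r = 0 := by
          rw [← RingHom.mem_ker]
          refine Ideal.map_le_iff_le_comap.2 (fun s hs => ?_) hr
          rw [Ideal.mem_comap, RingHom.mem_ker, ← IsScalarTower.algebraMap_apply, hS,
            (RingHom.mem_ker).1 hs, map_zero]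
        rw [this, zero_mul]
    have h1 := congrArg R e
    rw [map_add, hRw, add_zero, hR, hz, smul_zero, Finsupp.linearCombination_apply, Finsupp.sum,
      map_sum, Finset.sum_congr rfl fun I hI => by rw [map_smul, hRη I hI],
      Finset.sum_eq_single K (fun I _ hI => by rw [if_neg (Ne.symm hI), smul_zero])
        (fun h => absurd hK h), if_pos rfl, Algebra.smul_def, mul_one] at h1
    exact hker _ h1
  rw [← e, map_add, LinearMap.mem_ker.1 (range_sup_le_ker_baseChange (barD k A n)
    le_sup_left le_sup_right hw), add_zero, Finsupp.linearCombination_apply, Finsupp.sum, map_sum]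
  refine Finset.sum_eq_zero fun I hI => ?_
  rw [map_smul, baseChange_quotient_eq_zero le_sup_right (hcoef I hI)]

/-- Hochschild cycles of a smooth algebra on which all derivations vanish are boundaries. -/
theorem mem_range_barD [Algebra.Smooth k A] {n : ℕ} {z : Bar k A n}
    (hz : closeUp k A n z ∈ cycles k A n)
    (hD : ∀ D : Fin n → Derivation k A A, derPairing D (closeUp k A n z) = 0) :
    z ∈ LinearMap.range (barD k A n) ⊔ KaehlerDifferential.ideal k A • ⊤ := by
  refine mem_of_forall_prime _ le_sup_right z fun p hp => ?_
  obtain ⟨f, hf, N, a, δ, hδ, T, _, _, _, x, hx, hreg, ⟨μ, hμ, hμ'⟩, t, ht, ht'⟩ :=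
    exists_chart k p
  have : Module.Flat (A ⊗[k] A) T :=
    IsLocalization.flat T (Submonoid.powers (f ⊗ₜ[k] f : A ⊗[k] A))
  have : Module.FinitePresentation A (Ω[A⁄k]) := inferInstance
  refine ⟨f, hf, mem_of_localized (T := T) _ _ z ?_⟩
  have h := one_tmul_mem_span a x hx hreg t ht ht' hz
  rw [sup_assoc] at h
  let : Algebra T (Localization.Away f) := μ.toAlgebra
  let : Algebra (A ⊗[k] A) (Localization.Away f) :=
    (μ.comp (algebraMap (A ⊗[k] A) T)).toAlgebra
  have : IsScalarTower (A ⊗[k] A) T (Localization.Away f) := IsScalarTower.of_algebraMap_eq' rfl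
  exact baseChange_one_tmul_eq_zero (L := Localization.Away f) hμ' (fun c hc => hμ hc) a δ hδ h
    fun D => derPairing_localization f (Localization.Away f) hD D

end Detection

end HochschildHKR
end

noncomputable section

namespace HochschildHKR

universe u v

/-! ### Differential forms as functions of derivations -/

section Forms

/-- Forms on a finite projective module are detected by families of linear forms. -/
theorem exteriorPower_eq_zero {R M : Type*} [CommRing R] [AddCommGroup M] [Module R M]
    [Module.Finite R M] [Module.Projective R M] {n : ℕ} (ω : ⋀[R]^n M)
    (h : ∀ f : Fin n → Module.Dual R M,
      exteriorPower.pairingDual R M n (exteriorPower.ιMulti R n f) ω = 0) : ω = 0 := by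
  -- `M` is a retract of a free module, where a form is determined by its coordinates. These are
  -- pairings with dual basis elements, which pull back to linear forms on `M`.
  obtain ⟨m, p, g, -, -, hpg⟩ := Module.Finite.exists_comp_eq_id_of_projective R M
  have hg : exteriorPower.map n g ω = 0 := by
    refine (Module.Basis.exteriorPower n (Pi.basisFun R (Fin m))).ext_elem fun s => ?_
    rw [exteriorPower.basis_repr_apply, map_zero, Finsupp.zero_apply, exteriorPower.ιMultiDual,
      exteriorPower.ιMulti_family]
    have e : ∀ f : Fin n → Module.Dual R (Fin m → R),
        exteriorPower.pairingDual R _ n (exteriorPower.ιMulti R n f) ∘ₗ exteriorPower.map n g =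
          exteriorPower.pairingDual R M n (exteriorPower.ιMulti R n fun i => f i ∘ₗ g) := fun f =>
      exteriorPower.linearMap_ext (by
        ext v
        simp [exteriorPower.map_apply_ιMulti])
    exact (LinearMap.congr_fun (e _) ω).trans (h _)
  have h1 : exteriorPower.map n p ∘ₗ exteriorPower.map n g = LinearMap.id := by
    rw [← exteriorPower.map_comp, hpg, exteriorPower.map_id]
  have h2 := LinearMap.congr_fun h1 ω
  rwa [LinearMap.comp_apply, hg, map_zero, eq_comm] at h2

variable (k : Type u) [CommRing k] (A : Type v) [CommRing A] [Algebra k A]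

theorem span_ιMulti_D (n : ℕ) : Submodule.span A (Set.range fun a : Fin n → A =>
    exteriorPower.ιMulti A n fun j => KaehlerDifferential.D k A (a j)) = ⊤ := by
  rw [← exteriorPower.ιMulti_span_of_span A n _ (KaehlerDifferential.span_range_derivation k A)]
  congr 1
  ext ω
  constructor
  · rintro ⟨a, rfl⟩
    exact ⟨_, by rintro _ ⟨j, rfl⟩; exact ⟨_, rfl⟩, rfl⟩
  · rintro ⟨w, hw, rfl⟩
    choose a ha using fun j => hw ⟨j, rfl⟩
    exact ⟨a, congrArg _ (funext ha)⟩

variable {k A} in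
/-- Additive statements about forms can be checked on the forms `a₀ da₁ ∧ ⋯ ∧ da_n`. -/
theorem form_induction {n : ℕ} {p : ⋀[A]^n (Ω[A⁄k]) → Prop} (ω : ⋀[A]^n (Ω[A⁄k]))
    (h : ∀ (a₀ : A) (a : Fin n → A),
      p (a₀ • exteriorPower.ιMulti A n fun j => KaehlerDifferential.D k A (a j)))
    (h0 : p 0) (hadd : ∀ x y, p x → p y → p (x + y)) : p ω := by
  have hω : ω ∈ Submodule.span A (Set.range fun a : Fin n → A =>
      exteriorPower.ιMulti A n fun j => KaehlerDifferential.D k A (a j)) := by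
    rw [span_ιMulti_D]
    trivial
  -- The predicate is only additive, so the span induction carries an arbitrary coefficient, which
  -- absorbs scalar multiplication.
  rw [← one_smul A ω]
  generalize (1 : A) = c
  induction hω using Submodule.span_induction generalizing c with
  | mem x hx =>
    obtain ⟨a, rfl⟩ := hx
    exact h c a
  | zero => rwa [smul_zero]
  | add x y _ _ hx hy =>
    rw [smul_add]
    exact hadd _ _ (hx c) (hy c)
  | smul b x _ hx =>
    rw [← mul_smul]
    exact hx _

/-- The pairing of forms with families of derivations. -/
def formPairing (n : ℕ) : ⋀[A]^n (Ω[A⁄k]) →ₗ[k] (Fin n → Derivation k A A) → A :=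
  LinearMap.pi fun D => (exteriorPower.pairingDual A (Ω[A⁄k]) n
    (exteriorPower.ιMulti A n fun i => (D i).liftKaehlerDifferential)).restrictScalars k

variable {k A} in
theorem formPairing_apply {n : ℕ} (a₀ : A) (a : Fin n → A) (D : Fin n → Derivation k A A) :
    formPairing k A n (a₀ • exteriorPower.ιMulti A n fun j => KaehlerDifferential.D k A (a j)) D =
      a₀ * (Matrix.of fun i j => D j (a i)).det := by
  simp [formPairing]

/-- Every linear form on the differentials comes from a derivation, so the pairings with derivations
already detect forms. -/
theorem formPairing_injective [Module.Finite A (Ω[A⁄k])] [Module.Projective A (Ω[A⁄k])] (n : ℕ) :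
    Function.Injective (formPairing k A n) := by
  rw [injective_iff_map_eq_zero]
  intro ω hω
  refine exteriorPower_eq_zero ω fun f => ?_
  have h : formPairing k A n ω (fun i => (f i).compDer (KaehlerDifferential.D k A)) = 0 :=
    congrFun hω _
  have e : ∀ i, ((f i).compDer (KaehlerDifferential.D k A)).liftKaehlerDifferential = f i :=
    fun i => Derivation.liftKaehlerDifferential_unique _ _ (by
      ext
      simp)
  simpa only [formPairing, LinearMap.pi_apply, LinearMap.restrictScalars_apply, e] using h

end Forms

/-! ### The Hochschild–Kostant–Rosenberg isomorphism -/

section Homology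

open Submodule

/-- The chain is a closed-up Koszul element, whose bar differential has coefficients in the diagonal
ideal and so dies on closing up. -/
theorem antisymmetrization_mem_cycles {k : Type u} [CommRing k] {A : Type v} [CommRing A]
    [Algebra k A] {n : ℕ} (a₀ : A) (a : Fin n → A) : antisymmetrization k a₀ a ∈ cycles k A n := by
  cases n with
  | zero => trivial
  | succ n =>
    change hochschildB k A n _ = 0
    have h := closeUp_smul_antisymBar k (a₀ ⊗ₜ[k] (1 : A)) a
    rw [Algebra.TensorProduct.lmul'_apply_tmul, mul_one] at h
    rw [← h, hochschildB_closeUp, map_smul, closeUp_smul, barD_antisymBar]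
    rw [(closeUp_eq_zero_iff k A n _).2, mul_zero]
    refine sum_mem fun i _ => ?_
    exact smul_mem _ _ (smul_mem_smul (tmul_sub_mem_ideal k A _) trivial)

variable (k : Type u) [Field k] (A : Type v) [CommRing A] [Algebra k A]

/-- The pairing of Hochschild homology with families of derivations. -/
def homologyPairing (n : ℕ) : HH k A n →ₗ[k] (Fin n → Derivation k A A) → A :=
  Submodule.liftQ _ ((LinearMap.pi fun D => derPairing D) ∘ₗ (cycles k A n).subtype) (by
    rintro ⟨z, hz⟩ ⟨y, hy⟩
    ext D
    change derPairing D z = 0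
    have hy : hochschildB k A n y = z := hy
    rw [← hy, derPairing_hochschildB])

variable {k A}

theorem homologyPairing_mk {n : ℕ} (z : Chains k A n) (hz : z ∈ cycles k A n)
    (D : Fin n → Derivation k A A) : homologyPairing k A n (HH.mk k z hz) D = derPairing D z := rfl

theorem HH.induction {n : ℕ} {p : HH k A n → Prop} (h : ∀ z hz, p (HH.mk k z hz))
    (y : HH k A n) : p y := by
  obtain ⟨⟨z, hz⟩, rfl⟩ := Submodule.mkQ_surjective _ y
  exact h z hz

theorem closeUp_mem_boundaries {n : ℕ} {z : Bar k A n}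
    (hz : z ∈ LinearMap.range (barD k A n) ⊔ KaehlerDifferential.ideal k A • ⊤) :
    closeUp k A n z ∈ boundaries k A n := by
  obtain ⟨_, ⟨y, rfl⟩, w, hw, rfl⟩ := mem_sup.1 hz
  rw [map_add, (closeUp_eq_zero_iff k A n w).2 hw, add_zero, ← hochschildB_closeUp]
  exact ⟨_, rfl⟩

theorem homologyPairing_injective [Algebra.Smooth k A] (n : ℕ) :
    Function.Injective (homologyPairing k A n) := by
  rw [injective_iff_map_eq_zero]
  refine HH.induction fun z hz h => ?_
  obtain ⟨y, rfl⟩ := closeUp_surjective k A n z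
  exact (Submodule.Quotient.mk_eq_zero _).2
    (closeUp_mem_boundaries (mem_range_barD hz fun D => congrFun h D))

theorem formPairing_eq_homologyPairing {n : ℕ} (a₀ : A) (a : Fin n → A) :
    formPairing k A n (a₀ • exteriorPower.ιMulti A n fun j => KaehlerDifferential.D k A (a j)) =
      homologyPairing k A n (HH.mk k _ (antisymmetrization_mem_cycles a₀ a)) := by
  ext D
  rw [formPairing_apply, homologyPairing_mk, derPairing_antisymmetrization]
  rfl

/-- The forms `a₀ da₁ ∧ ⋯ ∧ da_n` and the antisymmetrized cycles have equal pairings. The former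
generate all forms, the latter all homology by `mem_span_antisymBar`. -/
theorem range_formPairing [Algebra.Smooth k A] (n : ℕ) :
    LinearMap.range (formPairing k A n) = LinearMap.range (homologyPairing k A n) := by
  apply le_antisymm
  · rintro _ ⟨ω, rfl⟩
    refine form_induction (p := fun ω => formPairing k A n ω ∈
      LinearMap.range (homologyPairing k A n)) ω (fun a₀ a => ?_) ?_ fun x y hx hy => ?_
    · exact ⟨_, (formPairing_eq_homologyPairing a₀ a).symm⟩
    · rw [map_zero]
      exact zero_mem _
    · rw [map_add]
      exact add_mem hx hy
  · rintro _ ⟨y, rfl⟩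
    revert y
    refine HH.induction fun z hz => ?_
    obtain ⟨y, rfl⟩ := closeUp_surjective k A n z
    obtain ⟨y', hy', w, hw, rfl⟩ := mem_sup.1 (mem_span_antisymBar hz)
    have hw' : ∀ D : Fin n → Derivation k A A, derPairing D (closeUp k A n w) = 0 := fun D => by
      obtain ⟨v, hv⟩ := closeUp_mem_boundaries hw
      rw [← hv, derPairing_hochschildB]
    -- The scalar `s` is kept arbitrary so that the span induction over `A ⊗ A` closes; only `s = 1`
    -- is needed.
    have hform : ∀ s : A ⊗[k] A, ∃ ω : ⋀[A]^n (Ω[A⁄k]), ∀ D,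
        formPairing k A n ω D = derPairing D (closeUp k A n (s • y')) := by
      clear hz
      induction hy' using Submodule.span_induction with
      | mem y hy =>
        obtain ⟨a, rfl⟩ := hy
        refine fun s => ⟨Algebra.TensorProduct.lmul' k s •
          exteriorPower.ιMulti A n fun j => KaehlerDifferential.D k A (a j), fun D => ?_⟩
        rw [closeUp_smul_antisymBar]
        exact congrFun (formPairing_eq_homologyPairing _ a) D
      | zero => exact fun s => ⟨0, fun D => by simp⟩
      | add x y _ _ hx hy =>
        intro s
        obtain ⟨ω, hω⟩ := hx s
        obtain ⟨ω', hω'⟩ := hy s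
        refine ⟨ω + ω', fun D => ?_⟩
        rw [map_add, Pi.add_apply, hω, hω', smul_add, map_add, map_add]
      | smul c x _ hx =>
        intro s
        rw [← mul_smul]
        exact hx _
    obtain ⟨ω, hω⟩ := hform 1
    refine ⟨ω, funext fun D => ?_⟩
    rw [hω, one_smul, homologyPairing_mk, map_add, map_add, hw', add_zero]

variable (k A) in
/-- The Hochschild–Kostant–Rosenberg isomorphism. -/
def hkrEquiv [Algebra.Smooth k A] (n : ℕ) : ⋀[A]^n (Ω[A⁄k]) ≃ₗ[k] HH k A n :=
  LinearEquiv.ofInjective (formPairing k A n) (formPairing_injective k A n) ≪≫ₗ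
    LinearEquiv.ofEq _ _ (range_formPairing n) ≪≫ₗ
    (LinearEquiv.ofInjective (homologyPairing k A n) (homologyPairing_injective n)).symm

theorem homologyPairing_hkrEquiv [Algebra.Smooth k A] {n : ℕ} (ω : ⋀[A]^n (Ω[A⁄k])) :
    homologyPairing k A n (hkrEquiv k A n ω) = formPairing k A n ω := by
  have h := congrArg Subtype.val (LinearEquiv.apply_symm_apply
    (LinearEquiv.ofInjective (homologyPairing k A n) (homologyPairing_injective n))
    (LinearEquiv.ofEq _ _ (range_formPairing n)
      (LinearEquiv.ofInjective (formPairing k A n) (formPairing_injective k A n) ω)))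
  exact h

theorem hkrEquiv_apply [Algebra.Smooth k A] {n : ℕ} (a₀ : A) (a : Fin n → A) :
    hkrEquiv k A n (a₀ • exteriorPower.ιMulti A n fun j => KaehlerDifferential.D k A (a j)) =
      HH.mk k _ (antisymmetrization_mem_cycles a₀ a) :=
  homologyPairing_injective n (by
    rw [homologyPairing_hkrEquiv, formPairing_eq_homologyPairing])

end Homology

end HochschildHKR
end

noncomputable section

namespace HochschildHKR

universe u v

/-! ### The Connes–Tsygan differential as the de Rham differential -/

section Connes

/-- Rotation by one step is a cycle of length `n + 1`. This identifies the sign `(-1) ^ (n * j)` in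
Connes' operator with the sign of the rotation. -/
theorem sign_addRight {n : ℕ} (j : Fin (n + 1)) :
    Equiv.Perm.sign (Equiv.addRight j : Equiv.Perm (Fin (n + 1))) = (-1) ^ (n * j.val) := by
  induction j using Fin.induction with
  | zero => simp [Equiv.addRight_zero]
  | succ j ih =>
    have e : (Equiv.addRight j.succ : Equiv.Perm (Fin (n + 1))) =
        finRotate (n + 1) * Equiv.addRight j.castSucc := by
      ext i : 1
      rw [Equiv.Perm.mul_apply, finRotate_apply, Equiv.coe_addRight, Equiv.coe_addRight, add_assoc,
        Fin.coeSucc_eq_succ]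
    rw [e, map_mul, ih, sign_finRotate, Fin.val_castSucc, Fin.val_succ, ← pow_add]
    congr 1
    rw [Nat.add_sub_cancel]
    ring

theorem sum_perm_rotate {M : Type*} [AddCommMonoid M] {n : ℕ}
    (g : Equiv.Perm (Fin (n + 1)) → M) :
    ∑ σ, g σ = ∑ j : Fin (n + 1), ∑ τ : Equiv.Perm (Fin n),
      g (Equiv.Perm.decomposeFin.symm (0, τ) * Equiv.addRight j) := by
  rw [← Fintype.sum_prod_type']
  refine (Function.Bijective.sum_comp (e := fun p : Fin (n + 1) × Equiv.Perm (Fin n) =>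
    Equiv.Perm.decomposeFin.symm (0, p.2) * Equiv.addRight p.1) ?_ g).symm
  refine (Fintype.bijective_iff_injective_and_card _).2 ⟨?_, ?_⟩
  · rintro ⟨i, τ⟩ ⟨i', τ'⟩ h
    have hi : i = i' := by
      -- The rotation is recovered from the product as the negative of the preimage of `0`, since
      -- the other factor fixes `0`.
      have h1 := DFunLike.congr_fun h (-i)
      simp only [Equiv.Perm.mul_apply, Equiv.coe_addRight, neg_add_cancel,
        Equiv.Perm.decomposeFin_symm_apply_zero] at h1
      have h2 : Equiv.Perm.decomposeFin.symm (0, τ') 0 = 0 := by simp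
      have h3 := (Equiv.Perm.decomposeFin.symm (0, τ')).injective (h2.trans h1)
      exact neg_injective (eq_neg_of_add_eq_zero_left h3.symm)
    subst hi
    simpa using h
  · simp [Fintype.card_perm, Nat.factorial_succ]

variable {k : Type u} [CommRing k] {A : Type v} [CommRing A] [Algebra k A]

theorem derPairing_push_succ {n : ℕ} (D : Fin (n + 1) → Derivation k A A) (j : Fin (n + 1))
    (b : Fin (n + 1) → A) :
    derPairing D (push k (fun x => (x - j).succ) (PiTensorProduct.tprod k b)) =
      ∏ i, D i (b (i + j)) := by
  rw [push_tprod, derPairing_tprod]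
  have h0 : (Finset.univ.filter fun x : Fin (n + 1) => (x - j).succ = 0) = ∅ := by
    ext x
    simp
  have hs : ∀ i : Fin (n + 1), (Finset.univ.filter fun x : Fin (n + 1) =>
      (x - j).succ = i.succ) = {i + j} := fun i => by
    ext x
    simp [sub_eq_iff_eq_add]
  rw [h0]
  simp only [hs, Finset.prod_singleton, Finset.prod_empty, map_one, one_mul]

/-- The last factor is `1`, and a derivation kills it, so half of Connes' operator is invisible to
the pairing. -/
theorem derPairing_push_castSucc {n : ℕ} (D : Fin (n + 1) → Derivation k A A) (j : Fin (n + 1))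
    (b : Fin (n + 1) → A) :
    derPairing D (push k (fun x => (x - j).castSucc) (PiTensorProduct.tprod k b)) = 0 := by
  rw [push_tprod, derPairing_tprod]
  have h0 : (Finset.univ.filter fun x : Fin (n + 1) => (x - j).castSucc = (Fin.last n).succ) =
      ∅ := by
    ext x
    simp [Fin.ext_iff, (Fin.is_lt _).ne]
  rw [Finset.prod_eq_zero (Finset.mem_univ (Fin.last n)), mul_zero]
  rw [h0, Finset.prod_empty, Derivation.map_one_eq_zero]

theorem derPairing_connesChain_tprod {n : ℕ} (D : Fin (n + 1) → Derivation k A A)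
    (b : Fin (n + 1) → A) : derPairing D (connesChain k A n (PiTensorProduct.tprod k b)) =
      ∑ j : Fin (n + 1), Equiv.Perm.sign (Equiv.addRight j) • ∏ i, D i (b (i + j)) := by
  rw [connesChain, linearMap_sum_apply, map_sum]
  refine Finset.sum_congr rfl fun j _ => ?_
  rw [LinearMap.smul_apply, LinearMap.add_apply, LinearMap.smul_apply, map_smul, map_add, map_smul,
    derPairing_push_succ, derPairing_push_castSucc, smul_zero, add_zero, sign_addRight,
    Units.smul_def]
  rcases neg_one_pow_eq_or ℤ (n * j.val) with h | h <;>
    rcases (n * j.val).even_or_odd with h' | h' <;> simp [h'.neg_one_pow]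

/-- Antisymmetrization runs over permutations fixing `0`, and Connes' operator over rotations.
Together they run once through all permutations of `n + 1` letters. -/
theorem derPairing_connesChain {n : ℕ} (D : Fin (n + 1) → Derivation k A A) (a₀ : A)
    (a : Fin n → A) : derPairing D (connesChain k A n (antisymmetrization k a₀ a)) =
      (Matrix.of fun i j => D j ((Fin.cons a₀ a : Fin (n + 1) → A) i)).det := by
  rw [Matrix.det_apply, sum_perm_rotate, Finset.sum_comm, antisymmetrization, map_sum, map_sum]
  refine Finset.sum_congr rfl fun σ _ => ?_
  rw [Units.smul_def, map_zsmul, map_zsmul, derPairing_connesChain_tprod, Finset.smul_sum]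
  refine Finset.sum_congr rfl fun j _ => ?_
  rw [map_mul, Equiv.Perm.decomposeFin.symm_sign, if_pos rfl, one_mul, mul_smul, ← Units.smul_def]
  congr 2
  refine Finset.prod_congr rfl fun i _ => ?_
  rw [Matrix.of_apply, Equiv.Perm.mul_apply, Equiv.coe_addRight]
  have h : ∀ l : Fin (n + 1), (Fin.cons a₀ (a ∘ σ) : Fin (n + 1) → A) l =
      (Fin.cons a₀ a : Fin (n + 1) → A) (Equiv.Perm.decomposeFin.symm (0, σ) l) := fun l => by
    induction l using Fin.cases with
    | zero => simp
    | succ l => simp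
  rw [h]

end Connes

/-- Under the Hochschild–Kostant–Rosenberg isomorphism, the Connes–Tsygan differential is the
de Rham differential. -/
theorem connesB_hkrEquiv {k : Type u} [Field k] {A : Type v} [CommRing A] [Algebra k A]
    [Algebra.Smooth k A] {n : ℕ} (ω : ⋀[A]^n (Ω[A⁄k])) :
    connesB k A n (hkrEquiv k A n ω) = hkrEquiv k A (n + 1) (deRham k A n ω) := by
  refine form_induction (p := fun ω => connesB k A n (hkrEquiv k A n ω) =
    hkrEquiv k A (n + 1) (deRham k A n ω)) ω (fun a₀ a => ?_) (by simp only [map_zero]) fun x y hx hy => ?_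
  · refine homologyPairing_injective (n + 1) (funext fun D => ?_)
    rw [homologyPairing_hkrEquiv, deRham_apply, hkrEquiv_apply,
      -- The form `da₀ ∧ ⋯ ∧ da_n` is given the coefficient `1` so that the determinant formula for
      -- its pairing applies.
      ← one_smul A (exteriorPower.ιMulti A (n + 1) _), formPairing_apply, one_mul]
    exact derPairing_connesChain D a₀ a
  · simp only [map_add, hx, hy]

end HochschildHKR
end

open HochschildHKR in
theorem theoremB {k : Type*} [Field k] {A : Type*} [CommRing A] [Algebra k A]
    [Algebra.Smooth k A] :
    ∃ hkr : ∀ i : ℕ, ⋀[A]^i (Ω[A⁄k]) ≃ₗ[k] HH k A i,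
      (∀ (i : ℕ) (a₀ : A) (a : Fin i → A),
        ∃ hz : antisymmetrization k a₀ a ∈ cycles k A i,
          hkr i (a₀ • exteriorPower.ιMulti A i fun j => KaehlerDifferential.D k A (a j)) =
            HH.mk k (antisymmetrization k a₀ a) hz) ∧
      ∀ (i : ℕ) (ω : ⋀[A]^i (Ω[A⁄k])), connesB k A i (hkr i ω) = hkr (i + 1) (deRham k A i ω) :=
  ⟨hkrEquiv k A, fun _ a₀ a => ⟨antisymmetrization_mem_cycles a₀ a, hkrEquiv_apply a₀ a⟩,
    fun _ => connesB_hkrEquiv⟩
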